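/- A \emph{partition of degree $n$} is an equivalence relation $\alpha$ on $\{1,\dots,n\}\cup\{1',\dots,n'\}$; its classes are called blocks. The product $\alpha\beta$ is obtained by renaming each $i'$ to $i''$ in $\alpha$ and each $i$ to $i''$ in $\beta$, taking the smallest equivalence relation on $\{1,\dots,n\}\cup\{1'',\dots,n''\}\cup\{1',\dots,n'\}$ containing both, and restricting it to $\{1,\dots,n\}\cup\{1',\dots,n'\}$. This gives the partition monoid $\mathcal P_n$. The \emph{partial Brauer monoid} $\mathcal{PB}_n$ is the submonoid of partitions all of whose blocks have size at most $2$. The symmetric group $\mathcal S_n$ is embedded in $\mathcal{PB}_n$ by sending a permutation $\sigma$ to the partition with blocks $\{i,(i\sigma)'\}$. The \emph{rank} of $\alpha$ is the number of blocks containing points of both $\{1,\dots,n\}$ and $\{1',\dots,n'\}$; the \emph{kernel} $\ker(\alpha)$ is the restriction of $\alpha$ to $\{1,\dots,n\}$, the \emph{cokernel} is $\operatorname{coker}(\alpha)=\ker(\alpha^*)$, where $\alpha^*$ is obtained from $\alpha$ by swapping $i$ and $i'$ for all $i$, and each is \emph{trivial} if it is the equality relation. A \emph{maximal subsemigroup}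 (\emph{maximal subgroup}) is a proper subsemigroup (subgroup) contained in no other proper subsemigroup (subgroup). A subsemigroup $M$ of a finite monoid $S$ \emph{arises from} a $\mathscr J$-class $J$ of $S$ if $S\setminus M\subseteq J$. \textbf{Theorem.} Let $n\ge 2$. The maximal subsemigroups of $\mathcal{PB}_n$ are precisely: \begin{enumerate} \item[(a)] $(\mathcal{PB}_n\setminus\mathcal S_n)\cup U$, where $U$ is a maximal subgroup of $\mathcal S_n$; it arises from a $\mathscr J$-class $J$ all of whose $\mathscr H$-classes it meets; \item[(b)] $\mathcal{PB}_n\setminus\{\alpha\in\mathcal{PB}_n:\operatorname{rank}(\alpha)=n-1\}$; it arises from a $\mathscr J$-class $J$ which it does not meet; \item[(c)] $\mathcal{PB}_n\setminus\{\alpha\in\mathcal{PB}_n:\operatorname{rank}(\alpha)=n-2\text{ and }\ker(\alpha)\text{ is non-trivial}\}$; it arises from a $\mathscr J$-class $J$ which it meets in a non-empty union of $\mathscr R$-classes; \item[(d)] $\mathcal{PB}_n\setminus\{\alpha\in\mathcal{PB}_n:\operatorname{rank}(\alpha)=n-2\text{ and }\operatorname{coker}(\alpha)\text{ is non-trivial}\}$;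 it arises from a $\mathscr J$-class $J$ which it meets in a non-empty union of $\mathscr L$-classes. \end{enumerate} In particular, for $n\ge 2$ there are $s_n+3$ maximal subsemigroups of $\mathcal{PB}_n$, where $s_n$ is the number of maximal subgroups of the symmetric group of degree $n$. Moreover $\mathcal{PB}_1=\mathcal P_1$ is a semilattice of order $2$, and its maximal subsemigroups are precisely its singleton subsets. -/

import Mathlib

/-! ## Maximal subsemigroups, Green's relations and types -/

/-- A maximal subsemigroup of `S`, as a subset: a proper subsemigroup contained in no other
proper subsemigroup. -/
def IsMaximalSubsemigroup {S : Type*} [Mul S] (M : Set S) : Prop :=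
  ∃ T : Subsemigroup S, IsCoatom T ∧ (T : Set S) = M

/-- The principal left ideal `Sx ∪ {x}`. -/
def principalLeftIdeal {S : Type*} [Mul S] (x : S) : Set S :=
  {y | y = x ∨ ∃ s, y = s * x}

/-- The principal right ideal `xS ∪ {x}`. -/
def principalRightIdeal {S : Type*} [Mul S] (x : S) : Set S :=
  {y | y = x ∨ ∃ s, y = x * s}

/-- The principal two-sided ideal `SxS ∪ Sx ∪ xS ∪ {x}`. -/
def principalIdeal {S : Type*} [Mul S] (x : S) : Set S :=
  {y | y = x ∨ (∃ s, y = s * x) ∨ (∃ s, y = x * s) ∨ ∃ s t, y = s * x * t}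

/-- The class of `x` under Green's relation `ℒ`. -/
def greenLClass {S : Type*} [Mul S] (x : S) : Set S :=
  {y | principalLeftIdeal y = principalLeftIdeal x}

/-- The class of `x` under Green's relation `ℛ`. -/
def greenRClass {S : Type*} [Mul S] (x : S) : Set S :=
  {y | principalRightIdeal y = principalRightIdeal x}

/-- The class of `x` under Green's relation `ℋ = ℒ ∩ ℛ`. -/
def greenHClass {S : Type*} [Mul S] (x : S) : Set S :=
  greenLClass x ∩ greenRClass x

/-- The class of `x` under Green's relation `𝒥`. -/
def greenJClass {S : Type*} [Mul S] (x : S) : Set S :=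
  {y | principalIdeal y = principalIdeal x}

/-- `J` is a `𝒥`-class of `S` from which `M` arises: it contains the complement of `M`. -/
def ArisesFrom {S : Type*} [Mul S] (M J : Set S) : Prop :=
  (∃ x, J = greenJClass x) ∧ Mᶜ ⊆ J

/-- `M` arises from a `𝒥`-class `J` with `M ∩ J = ∅`. -/
def HasTypeDisjoint {S : Type*} [Mul S] (M : Set S) : Prop :=
  ∃ J, ArisesFrom M J ∧ M ∩ J = ∅

/-- `M` arises from a `𝒥`-class `J` and `M ∩ J` is a non-empty union of
`ℒ`-classes. -/
def HasTypeUnionL {S : Type*} [Mul S] (M : Set S) : Prop :=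
  ∃ J, ArisesFrom M J ∧ (M ∩ J).Nonempty ∧ ∀ x ∈ M ∩ J, greenLClass x ⊆ M ∩ J

/-- `M` arises from a `𝒥`-class `J` and `M ∩ J` is a non-empty union of
`ℛ`-classes. -/
def HasTypeUnionR {S : Type*} [Mul S] (M : Set S) : Prop :=
  ∃ J, ArisesFrom M J ∧ (M ∩ J).Nonempty ∧ ∀ x ∈ M ∩ J, greenRClass x ⊆ M ∩ J

/-- `M` arises from a `𝒥`-class `J` and `M ∩ J` meets every `ℋ`-class
contained in `J`. -/
def HasTypeMeetsH {S : Type*} [Mul S] (M : Set S) : Prop :=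
  ∃ J, ArisesFrom M J ∧ ∀ x ∈ J, (M ∩ J ∩ greenHClass x).Nonempty

/-! ## Facts on equivalence relations used for the products of partitions -/

namespace SetoidAux

theorem map_le_iff {A B : Type*} (r : Setoid A) (f : A → B) (s : Setoid B) :
    r.map f ≤ s ↔ r ≤ s.comap f := by
  constructor
  · intro h x y hxy
    exact h (Relation.EqvGen.rel _ _ ⟨x, y, hxy, rfl, rfl⟩)
  · intro h
    refine Setoid.eqvGen_le ?_
    rintro _ _ ⟨a, b, hab, rfl, rfl⟩
    exact h hab

theorem map_sup {A B : Type*} (r s : Setoid A) (f : A → B) :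
    (r ⊔ s).map f = r.map f ⊔ s.map f := by
  apply eq_of_forall_ge_iff
  intro t
  simp only [map_le_iff, sup_le_iff]

theorem map_map {A B C : Type*} (r : Setoid A) (f : A → B) (g : B → C) :
    (r.map f).map g = r.map (g ∘ f) := by
  apply eq_of_forall_ge_iff
  intro t
  simp only [map_le_iff, Setoid.comap_comp]

theorem map_iff {A B : Type*} (r : Setoid A) (f : A → B) (hf : Function.Injective f) (x y : B) :
    r.map f x y ↔ x = y ∨ ∃ a b, r a b ∧ f a = x ∧ f b = y := by
  have h := Setoid.coe_map_of_ker_le r f (by rw [Setoid.ker_eq_bot_iff.2 hf]; exact bot_le)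
  rw [h, or_comm]
  rfl

theorem comap_sup {C D : Type*} (i : C → D) (s t : Setoid D)
    (ht : ∀ x y, t x y → x = y ∨ (x ∈ Set.range i ∧ y ∈ Set.range i)) :
    (s ⊔ t).comap i = s.comap i ⊔ t.comap i := by
  apply le_antisymm
  · let w : Setoid C := s.comap i ⊔ t.comap i
    have hsw : ∀ {c d}, s (i c) (i d) → w c d := fun {c d} h =>
      (le_sup_left : s.comap i ≤ w) h
    have htw : ∀ {c d}, t (i c) (i d) → w c d := fun {c d} h =>
      (le_sup_right : t.comap i ≤ w) h
    let E : Setoid D :=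
      { r := fun x y => s x y ∨ ∃ c d, s x (i c) ∧ w c d ∧ s (i d) y
        iseqv :=
          { refl := fun x => Or.inl (s.refl' x)
            symm := by
              rintro x y (h | ⟨c, d, h1, h2, h3⟩)
              · exact Or.inl (s.symm' h)
              · exact Or.inr ⟨d, c, s.symm' h3, w.symm' h2, s.symm' h1⟩
            trans := by
              rintro x y z (h | ⟨c, d, h1, h2, h3⟩) (h' | ⟨c', d', h1', h2', h3'⟩)
              · exact Or.inl (s.trans' h h')
              · exact Or.inr ⟨c', d', s.trans' h h1', h2', h3'⟩
              · exact Or.inr ⟨c, d, h1, h2, s.trans' h3 h'⟩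
              · exact Or.inr ⟨c, d', h1,
                  w.trans' h2 (w.trans' (hsw (s.trans' h3 h1')) h2'), h3'⟩ } }
    have hE : s ⊔ t ≤ E := by
      refine sup_le (fun x y h => Or.inl h) (fun x y h => ?_)
      rcases ht x y h with rfl | ⟨⟨c, rfl⟩, ⟨d, rfl⟩⟩
      · exact E.refl' _
      · exact Or.inr ⟨c, d, s.refl' _, htw h, s.refl' _⟩
    intro x y hxy
    rcases hE hxy with h | ⟨c, d, h1, h2, h3⟩
    · exact hsw h
    · exact w.trans' (hsw h1) (w.trans' h2 (hsw h3))
  · exact sup_le (fun x y h => (le_sup_left : s ≤ s ⊔ t) h)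
      (fun x y h => (le_sup_right : t ≤ s ⊔ t) h)

theorem comap_map {A B C D : Type*} (J : Setoid B) (k : B → D) (i : C → D) (h : A → B)
    (p : A → C) (hk : Function.Injective k) (hi : Function.Injective i)
    (hp : Function.Injective p) (hc : i ∘ p = k ∘ h)
    (hpb : ∀ c b, i c = k b → ∃ a, p a = c ∧ h a = b) :
    (J.map k).comap i = (J.comap h).map p := by
  ext x y
  change J.map k (i x) (i y) ↔ _
  rw [map_iff _ _ hk, map_iff _ _ hp]
  constructor
  · rintro (e | ⟨a, b, hab, e1, e2⟩)
    · exact Or.inl (hi e)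
    · obtain ⟨a', rfl, rfl⟩ := hpb _ _ e1.symm
      obtain ⟨b', rfl, rfl⟩ := hpb _ _ e2.symm
      exact Or.inr ⟨a', b', hab, rfl, rfl⟩
  · rintro (rfl | ⟨a, b, hab, rfl, rfl⟩)
    · exact Or.inl rfl
    · exact Or.inr ⟨h a, h b, hab, (congrFun hc a).symm, (congrFun hc b).symm⟩

theorem three_of_fixed {D : Type*} (a b : Setoid D) (A B : Equiv.Perm D)
    (hA : ∀ x, A (A x) = x) (hB : ∀ x, B (B x) = x)
    (ha : ∀ x y, a x y → y = x ∨ y = A x) (hb : ∀ x y, b x y → y = x ∨ y = B x)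
    (x y z : D) (hx : B x = x) (hy : A y = y ∨ B y = y) (hz : A z = z ∨ B z = z)
    (hxy : (a ⊔ b) x y) (hxz : (a ⊔ b) x z) : y = x ∨ z = x ∨ y = z := by
  set c : Equiv.Perm D := A * B with hc
  have hAA : A * A = 1 := Equiv.ext hA
  have hBB : B * B = 1 := Equiv.ext hB
  have hAi : A⁻¹ = A := inv_eq_of_mul_eq_one_left hAA
  have hBi : B⁻¹ = B := inv_eq_of_mul_eq_one_left hBB
  have hBc : ∀ k : ℤ, B * c ^ k = c ^ (-k) * B := by
    intro k
    have h1 : B * c * B⁻¹ = c⁻¹ := by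
      rw [hc, mul_inv_rev, hAi, hBi, mul_assoc, mul_assoc, hBB, mul_one]
    have h2 : B * c ^ k * B⁻¹ = c ^ (-k) := by rw [← conj_zpow, h1, inv_zpow, zpow_neg]
    rw [← h2, inv_mul_cancel_right]
  have hBk : ∀ k : ℤ, B ((c ^ k) x) = (c ^ (-k)) x := by
    intro k
    have := congrArg (fun p : Equiv.Perm D => p x) (hBc k)
    simpa [hx] using this
  have hAk : ∀ k : ℤ, A ((c ^ k) x) = (c ^ (1 - k)) x := by
    intro k
    have h1 : A ((c ^ k) x) = c (B ((c ^ k) x)) := by simp [hc, hB]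
    rw [h1, hBk, sub_eq_add_neg, zpow_add, zpow_one]
    rfl
  let O : Set D := {u | ∃ k : ℤ, u = (c ^ k) x}
  have hOA : ∀ u ∈ O, A u ∈ O := by
    rintro _ ⟨k, rfl⟩
    exact ⟨1 - k, hAk k⟩
  have hOB : ∀ u ∈ O, B u ∈ O := by
    rintro _ ⟨k, rfl⟩
    exact ⟨-k, hBk k⟩
  have hle : a ⊔ b ≤ Setoid.ker (fun u => u ∈ O) := by
    refine sup_le (fun u v h => ?_) (fun u v h => ?_)
    · refine propext ⟨fun hu => ?_, fun hv => ?_⟩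
      · rcases ha u v h with rfl | rfl
        exacts [hu, hOA _ hu]
      · rcases ha v u (a.symm' h) with rfl | rfl
        exacts [hv, hOA _ hv]
    · refine propext ⟨fun hu => ?_, fun hv => ?_⟩
      · rcases hb u v h with rfl | rfl
        exacts [hu, hOB _ hu]
      · rcases hb v u (b.symm' h) with rfl | rfl
        exacts [hv, hOB _ hv]
  have hxO : x ∈ O := ⟨0, by simp⟩
  obtain ⟨k, rfl⟩ : y ∈ O := (show (x ∈ O) = (y ∈ O) from hle hxy).mp hxO
  obtain ⟨l, rfl⟩ : z ∈ O := (show (x ∈ O) = (z ∈ O) from hle hxz).mp hxO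
  have heq : ∀ i j : ℤ, (c ^ i) x = (c ^ j) x → (c ^ (i - j)) x = x := by
    intro i j h
    have : (c ^ (-j)) ((c ^ i) x) = (c ^ (-j)) ((c ^ j) x) := by rw [h]
    rw [← Equiv.Perm.mul_apply, ← Equiv.Perm.mul_apply, ← zpow_add, ← zpow_add] at this
    simpa [sub_eq_neg_add] using this
  have hadd : ∀ i j : ℤ, (c ^ i) x = x → (c ^ j) x = x → (c ^ (i + j)) x = x := by
    intro i j hi hj
    rw [zpow_add, Equiv.Perm.mul_apply, hj, hi]
  let P : AddSubgroup ℤ :=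
    { carrier := {i | (c ^ i) x = x}
      add_mem' := fun {i j} hi hj => hadd i j hi hj
      zero_mem' := by simp
      neg_mem' := fun {i} hi => by
        have := heq 0 i (by simpa using hi.symm)
        simpa using this }
  have hk : 2 * k ∈ P ∨ 2 * k - 1 ∈ P := by
    rcases hy with h | h
    · right
      rw [hAk] at h
      have := heq _ _ h.symm
      rwa [show k - (1 - k) = 2 * k - 1 by ring] at this
    · left
      rw [hBk] at h
      have := heq _ _ h.symm
      rwa [show k - (-k) = 2 * k by ring] at this
  have hl : 2 * l ∈ P ∨ 2 * l - 1 ∈ P := by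
    rcases hz with h | h
    · right
      rw [hAk] at h
      have := heq _ _ h.symm
      rwa [show l - (1 - l) = 2 * l - 1 by ring] at this
    · left
      rw [hBk] at h
      have := heq _ _ h.symm
      rwa [show l - (-l) = 2 * l by ring] at this
  have key : k ∈ P ∨ l ∈ P ∨ k - l ∈ P := by
    obtain ⟨m, hm⟩ := Int.subgroup_cyclic P
    have hmem : ∀ i, i ∈ P ↔ m ∣ i := by
      intro i
      rw [hm, AddSubgroup.mem_closure_singleton]
      exact ⟨fun ⟨n, hn⟩ => ⟨n, by rw [← hn]; simp [mul_comm]⟩,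
        fun ⟨n, hn⟩ => ⟨n, by rw [hn]; simp [mul_comm]⟩⟩
    rw [hmem, hmem] at hk hl
    rw [hmem, hmem, hmem]
    have hodd : ∀ {i j : ℤ}, Odd m → m ∣ 2 * i → m ∣ i := fun {i j} ho hd =>
      (Int.isCoprime_iff_gcd_eq_one.2 (by
        have := ho.natAbs
        rw [Int.gcd, Nat.Coprime.gcd_eq_one]
        simpa using this)).dvd_of_dvd_mul_left hd
    rcases Int.even_or_odd m with he | ho
    · have hno : ∀ i : ℤ, ¬ m ∣ 2 * i - 1 := by
        intro i hd
        obtain ⟨q, hq⟩ := (even_iff_two_dvd.1 he).trans hd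
        omega
      obtain ⟨q, hq⟩ := hk.resolve_right (hno k)
      obtain ⟨r, hr⟩ := hl.resolve_right (hno l)
      obtain ⟨h, hh⟩ := he
      have hk' : k = h * q := by
        have : 2 * k = 2 * (h * q) := by rw [hq, hh]; ring
        omega
      have hl' : l = h * r := by
        have : 2 * l = 2 * (h * r) := by rw [hr, hh]; ring
        omega
      rcases Int.even_or_odd' q with ⟨q', e | e⟩
      · exact Or.inl ⟨q', by rw [hk', e, hh]; ring⟩
      · rcases Int.even_or_odd' r with ⟨r', f | f⟩
        · exact Or.inr (Or.inl ⟨r', by rw [hl', f, hh]; ring⟩)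
        · exact Or.inr (Or.inr ⟨q' - r', by rw [hk', hl', e, f, hh]; ring⟩)
    · rcases hk with hk | hk
      · exact Or.inl (hodd (j := 0) ho hk)
      · rcases hl with hl | hl
        · exact Or.inr (Or.inl (hodd (j := 0) ho hl))
        · refine Or.inr (Or.inr (hodd (j := 0) ho ?_))
          have := dvd_sub hk hl
          rwa [show 2 * k - 1 - (2 * l - 1) = 2 * (k - l) by ring] at this
  rcases key with h | h | h
  · exact Or.inl h
  · exact Or.inr (Or.inl h)
  · refine Or.inr (Or.inr ?_)
    have h' : (c ^ (k - l)) x = x := h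
    calc (c ^ k) x = (c ^ (l + (k - l))) x := by rw [add_sub_cancel]
      _ = (c ^ l) x := by rw [zpow_add, Equiv.Perm.mul_apply, h']

/-- An equivalence relation all of whose classes have at most two points is given by an
involution. -/
theorem exists_involution {D : Type*} (r : Setoid D)
    (h : ∀ x y z, r x y → r x z → y = x ∨ z = x ∨ y = z) :
    ∃ A : Equiv.Perm D, (∀ x, A (A x) = x) ∧ (∀ x, r x (A x)) ∧
      ∀ x y, r x y → y = x ∨ y = A x := by
  classical
  let f : D → D := fun x => if hx : ∃ y, r x y ∧ y ≠ x then hx.choose else x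
  have hf : ∀ x, r x (f x) := by
    intro x
    by_cases hx : ∃ y, r x y ∧ y ≠ x
    · simp only [f, dif_pos hx]
      exact hx.choose_spec.1
    · simp only [f, dif_neg hx]
      exact r.refl' x
  have hf2 : ∀ x y, r x y → y = x ∨ y = f x := by
    intro x y hxy
    by_cases hx : ∃ y, r x y ∧ y ≠ x
    · have hs := hx.choose_spec
      have hfx : f x = hx.choose := by simp only [f, dif_pos hx]
      rw [← hfx] at hs
      rcases h x y (f x) hxy hs.1 with e | e | e
      exacts [Or.inl e, absurd e hs.2, Or.inr e]
    · exact Or.inl (by by_contra hne; exact hx ⟨y, hxy, hne⟩)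
  have hinv : Function.Involutive f := by
    intro x
    rcases hf2 (f x) x (r.symm' (hf x)) with e | e
    · rw [← e, ← e]
    · exact e.symm
  exact ⟨hinv.toPerm, hinv, hf, hf2⟩

end SetoidAux

/-! ## The partition monoid -/

/-- A partition of degree `n`: an equivalence relation on `{1, …, n} ∪ {1', …, n'}`.
The point `Sum.inl i` stands for `i` and `Sum.inr i` for `i'`. -/
@[ext]
structure PartitionMonoid (n : ℕ) where
  rel : Setoid (Fin n ⊕ Fin n)

namespace PartitionMonoid

variable {n : ℕ}

/-- `{1, …, n} ∪ {1', …, n'} → {1, …, n} ∪ {1'', …, n''}` (renaming `i'` to `i''`), inside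
`{1, …, n} ∪ {1'', …, n''} ∪ {1', …, n'}`. -/
def upper (n : ℕ) : Fin n ⊕ Fin n → Fin n ⊕ (Fin n ⊕ Fin n) := Sum.map id Sum.inl

/-- `{1, …, n} ∪ {1', …, n'} → {1'', …, n''} ∪ {1', …, n'}` (renaming `i` to `i''`), inside
`{1, …, n} ∪ {1'', …, n''} ∪ {1', …, n'}`. -/
def lower (n : ℕ) : Fin n ⊕ Fin n → Fin n ⊕ (Fin n ⊕ Fin n) := Sum.inr

/-- The inclusion of `{1, …, n} ∪ {1', …, n'}` in
`{1, …, n} ∪ {1'', …, n''} ∪ {1', …, n'}`. -/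
def outer (n : ℕ) : Fin n ⊕ Fin n → Fin n ⊕ (Fin n ⊕ Fin n) := Sum.map id Sum.inr

/-- The smallest equivalence relation on `{1, …, n} ∪ {1'', …, n''} ∪ {1', …, n'}` that
contains the copy of `α` on the upper two rows and the copy of `β` on the lower two rows. -/
def joint (α β : PartitionMonoid n) : Setoid (Fin n ⊕ (Fin n ⊕ Fin n)) :=
  α.rel.map (upper n) ⊔ β.rel.map (lower n)

instance : Mul (PartitionMonoid n) where
  mul α β := ⟨(joint α β).comap (outer n)⟩

/-- The partition with blocks `{i, (σ i)'}`. -/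
def ofPerm (σ : Equiv.Perm (Fin n)) : PartitionMonoid n :=
  ⟨Setoid.ker (Sum.elim σ id)⟩

/-- The identity partition, with blocks `{i, i'}`. -/
instance : One (PartitionMonoid n) where
  one := ofPerm 1

theorem mul_rel (α β : PartitionMonoid n) : (α * β).rel = (joint α β).comap (outer n) := rfl

theorem upper_injective : Function.Injective (upper n) :=
  Sum.map_injective.2 ⟨Function.injective_id, Sum.inl_injective⟩

theorem lower_injective : Function.Injective (lower n) := Sum.inr_injective

theorem outer_injective : Function.Injective (outer n) :=
  Sum.map_injective.2 ⟨Function.injective_id, Sum.inr_injective⟩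

theorem ofPerm_mul (σ : Equiv.Perm (Fin n)) (β : PartitionMonoid n) :
    ofPerm σ * β = ⟨β.rel.comap (Sum.map σ id)⟩ := by
  have hup : ∀ i, joint (ofPerm σ) β (Sum.inl i) (Sum.inr (Sum.inl (σ i))) := fun i =>
    (le_sup_left : _ ≤ joint (ofPerm σ) β)
      (Relation.EqvGen.rel _ _ ⟨Sum.inl i, Sum.inr (σ i), rfl, rfl, rfl⟩)
  have hlo : ∀ x y, β.rel x y → joint (ofPerm σ) β (Sum.inr x) (Sum.inr y) := fun x y h =>
    (le_sup_right : _ ≤ joint (ofPerm σ) β) (Relation.EqvGen.rel _ _ ⟨x, y, h, rfl, rfl⟩)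
  have hcol : ∀ x, joint (ofPerm σ) β (outer n x) (Sum.inr (Sum.map σ id x)) := by
    rintro (i | j)
    · exact hup i
    · exact Setoid.refl' _ _
  have hle : joint (ofPerm σ) β ≤ β.rel.comap (Sum.elim (fun i => Sum.inl (σ i)) id) := by
    refine sup_le ?_ ?_
    · rw [SetoidAux.map_le_iff]
      have e : ∀ x, Sum.elim (fun i => (Sum.inl (σ i) : Fin n ⊕ Fin n)) id (upper n x) =
          Sum.inl (Sum.elim σ id x) := by rintro (i | j) <;> rfl
      intro x y h
      have h' : Sum.elim σ id x = Sum.elim σ id y := h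
      change β.rel _ _
      rw [e, e, h']
    · rw [SetoidAux.map_le_iff]
      exact fun x y h => h
  refine PartitionMonoid.ext (Setoid.ext fun x y => ⟨fun h => ?_, fun h => ?_⟩)
  · have := hle h
    have e : ∀ x, Sum.elim (fun i => (Sum.inl (σ i) : Fin n ⊕ Fin n)) id (outer n x) =
          Sum.map σ id x := by rintro (i | j) <;> rfl
    change β.rel _ _ at this
    rw [e, e] at this
    exact this
  · exact (joint (ofPerm σ) β).trans' (hcol x)
      ((joint (ofPerm σ) β).trans' (hlo _ _ h) ((joint (ofPerm σ) β).symm' (hcol y)))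

/-- The embedding of the symmetric group turns composition from left to right (`σ` first,
then `τ`) into the product of partitions. -/
theorem ofPerm_mul_ofPerm (σ τ : Equiv.Perm (Fin n)) :
    ofPerm σ * ofPerm τ = ofPerm (τ * σ) := by
  rw [ofPerm_mul]
  refine PartitionMonoid.ext ?_
  change (Setoid.ker _).comap _ = Setoid.ker _
  have : Sum.elim τ id ∘ Sum.map σ id = Sum.elim (τ * σ : Equiv.Perm (Fin n)) id := by
    ext (i | j) <;> rfl
  rw [← this]
  rfl

protected theorem one_mul (β : PartitionMonoid n) : 1 * β = β := by
  change ofPerm 1 * β = β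
  rw [ofPerm_mul]
  refine PartitionMonoid.ext ?_
  have : (Sum.map (1 : Equiv.Perm (Fin n)) id : Fin n ⊕ Fin n → Fin n ⊕ Fin n) = id := by
    ext (i | j) <;> rfl
  rw [this, Setoid.comap_id]

protected theorem mul_one (α : PartitionMonoid n) : α * 1 = α := by
  have hlo : ∀ i, joint α 1 (Sum.inr (Sum.inr i)) (Sum.inr (Sum.inl i)) := fun i =>
    (le_sup_right : _ ≤ joint α 1)
      (Relation.EqvGen.rel _ _ ⟨Sum.inr i, Sum.inl i, rfl, rfl, rfl⟩)
  have hup : ∀ x y, α.rel x y → joint α 1 (upper n x) (upper n y) := fun x y h =>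
    (le_sup_left : _ ≤ joint α 1) (Relation.EqvGen.rel _ _ ⟨x, y, h, rfl, rfl⟩)
  have hcol : ∀ x, joint α 1 (outer n x) (upper n x) := by
    rintro (i | j)
    · exact Setoid.refl' _ _
    · exact hlo j
  have hle : joint α 1 ≤ α.rel.comap (Sum.map id (Sum.elim id id)) := by
    refine sup_le ?_ ?_
    · rw [SetoidAux.map_le_iff]
      have e : ∀ x, Sum.map id (Sum.elim id id) (upper n x) = x := by rintro (i | j) <;> rfl
      intro x y h
      change α.rel _ _
      rw [e, e]
      exact h
    · rw [SetoidAux.map_le_iff]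
      have e : ∀ x, Sum.map id (Sum.elim id id) (lower n x) =
          Sum.inr (Sum.elim (1 : Equiv.Perm (Fin n)) id x) := by rintro (i | j) <;> rfl
      intro x y h
      have h' : Sum.elim (1 : Equiv.Perm (Fin n)) id x =
        Sum.elim (1 : Equiv.Perm (Fin n)) id y := h
      change α.rel _ _
      rw [e, e, h']
  refine PartitionMonoid.ext (Setoid.ext fun x y => ⟨fun h => ?_, fun h => ?_⟩)
  · have := hle h
    have e : ∀ x, Sum.map id (Sum.elim id id) (outer n x) = x := by rintro (i | j) <;> rfl
    change α.rel _ _ at this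
    rw [e, e] at this
    exact this
  · exact (joint α 1).trans' (hcol x)
      ((joint α 1).trans' (hup _ _ h) ((joint α 1).symm' (hcol y)))

/-- Inclusions of three rows in four rows; the missing row is indicated. -/
def omitLast (n : ℕ) : Fin n ⊕ (Fin n ⊕ Fin n) → Fin n ⊕ (Fin n ⊕ (Fin n ⊕ Fin n)) :=
  Sum.map id (Sum.map id Sum.inl)

/-- See `omitLast`. -/
def omitSecond (n : ℕ) : Fin n ⊕ (Fin n ⊕ Fin n) → Fin n ⊕ (Fin n ⊕ (Fin n ⊕ Fin n)) :=
  Sum.map id Sum.inr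

/-- See `omitLast`. -/
def omitThird (n : ℕ) : Fin n ⊕ (Fin n ⊕ Fin n) → Fin n ⊕ (Fin n ⊕ (Fin n ⊕ Fin n)) :=
  Sum.map id (Sum.map id Sum.inr)

/-- See `omitLast`. -/
def omitFirst (n : ℕ) : Fin n ⊕ (Fin n ⊕ Fin n) → Fin n ⊕ (Fin n ⊕ (Fin n ⊕ Fin n)) :=
  Sum.inr

theorem mul_mul_rel_left (α β γ : PartitionMonoid n) :
    (α * β * γ).rel = (α.rel.map (omitLast n ∘ upper n) ⊔ β.rel.map (omitLast n ∘ lower n) ⊔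
      γ.rel.map (omitSecond n ∘ lower n)).comap (omitSecond n ∘ outer n) := by
  have hL : Function.Injective (omitLast n) := Sum.map_injective.2
    ⟨Function.injective_id, Sum.map_injective.2 ⟨Function.injective_id, Sum.inl_injective⟩⟩
  have hS : Function.Injective (omitSecond n) := Sum.map_injective.2
    ⟨Function.injective_id, Sum.inr_injective⟩
  rw [Setoid.comap_comp, SetoidAux.comap_sup, ← SetoidAux.map_map, ← SetoidAux.map_map,
    ← SetoidAux.map_sup, ← SetoidAux.map_map, Setoid.comap_map_eq _ _ hS,
    SetoidAux.comap_map (α.rel.map (upper n) ⊔ β.rel.map (lower n)) (omitLast n) (omitSecond n)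
      (outer n) (upper n) hL hS upper_injective]
  · rfl
  · ext (i | i) <;> rfl
  · rintro (i | i | i) (j | j | j) h <;> simp [omitSecond, omitLast] at h <;> subst h
    · exact ⟨Sum.inl i, rfl, rfl⟩
    · exact ⟨Sum.inr i, rfl, rfl⟩
  · intro x y h
    rw [SetoidAux.map_iff _ _ (hS.comp lower_injective)] at h
    rcases h with h | ⟨a, b, -, rfl, rfl⟩
    · exact Or.inl h
    · exact Or.inr ⟨⟨_, rfl⟩, ⟨_, rfl⟩⟩

theorem mul_mul_rel_right (α β γ : PartitionMonoid n) :
    (α * (β * γ)).rel = (β.rel.map (omitFirst n ∘ upper n) ⊔ γ.rel.map (omitFirst n ∘ lower n) ⊔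
      α.rel.map (omitThird n ∘ upper n)).comap (omitThird n ∘ outer n) := by
  have hF : Function.Injective (omitFirst n) := Sum.inr_injective
  have hT : Function.Injective (omitThird n) := Sum.map_injective.2
    ⟨Function.injective_id, Sum.map_injective.2 ⟨Function.injective_id, Sum.inr_injective⟩⟩
  rw [Setoid.comap_comp, SetoidAux.comap_sup, ← SetoidAux.map_map, ← SetoidAux.map_map,
    ← SetoidAux.map_sup, ← SetoidAux.map_map, Setoid.comap_map_eq _ _ hT,
    SetoidAux.comap_map (β.rel.map (upper n) ⊔ γ.rel.map (lower n)) (omitFirst n) (omitThird n)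
      (outer n) (lower n) hF hT lower_injective, sup_comm]
  · rfl
  · ext (i | i) <;> rfl
  · rintro (i | i | i) (j | j | j) h <;> simp [omitFirst, omitThird] at h <;> subst h
    · exact ⟨Sum.inl i, rfl, rfl⟩
    · exact ⟨Sum.inr i, rfl, rfl⟩
  · intro x y h
    rw [SetoidAux.map_iff _ _ (hT.comp upper_injective)] at h
    rcases h with h | ⟨a, b, -, rfl, rfl⟩
    · exact Or.inl h
    · exact Or.inr ⟨⟨_, rfl⟩, ⟨_, rfl⟩⟩

protected theorem mul_assoc (α β γ : PartitionMonoid n) : α * β * γ = α * (β * γ) := by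
  refine PartitionMonoid.ext ?_
  have e1 : omitLast n ∘ upper n = omitThird n ∘ upper n := by ext (i | i) <;> rfl
  have e2 : omitLast n ∘ lower n = omitFirst n ∘ upper n := by ext (i | i) <;> rfl
  have e3 : omitSecond n ∘ lower n = omitFirst n ∘ lower n := by ext (i | i) <;> rfl
  have e4 : omitSecond n ∘ outer n = omitThird n ∘ outer n := by ext (i | i) <;> rfl
  rw [mul_mul_rel_left, mul_mul_rel_right, e1, e2, e3, e4, sup_assoc, sup_comm]

/-- The partition monoid of degree `n`. -/
instance : Monoid (PartitionMonoid n) where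
  mul_assoc := PartitionMonoid.mul_assoc
  one_mul := PartitionMonoid.one_mul
  mul_one := PartitionMonoid.mul_one

/-- The set of blocks of a partition. -/
def blocks (α : PartitionMonoid n) : Set (Set (Fin n ⊕ Fin n)) := α.rel.classes

/-- A block is transverse if it contains points from both rows. -/
def IsTransverse (b : Set (Fin n ⊕ Fin n)) : Prop :=
  (∃ i, Sum.inl i ∈ b) ∧ ∃ j, Sum.inr j ∈ b

/-- The rank of a partition: the number of its transverse blocks. -/
noncomputable def rank (α : PartitionMonoid n) : ℕ :=
  {b | b ∈ α.blocks ∧ IsTransverse b}.ncard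

/-- The partition `α*`, obtained by swapping `i` and `i'` for all `i`. -/
def star (α : PartitionMonoid n) : PartitionMonoid n := ⟨α.rel.comap Sum.swap⟩

/-- The kernel: the restriction of the equivalence relation to `{1, …, n}`. -/
def ker (α : PartitionMonoid n) : Setoid (Fin n) := α.rel.comap Sum.inl

/-- The cokernel `coker α = ker α*`. -/
def coker (α : PartitionMonoid n) : Setoid (Fin n) := α.star.ker

theorem blocks_ncard_le_two_iff (α : PartitionMonoid n) :
    (∀ b ∈ α.blocks, b.ncard ≤ 2) ↔
      ∀ x y z, α.rel x y → α.rel x z → y = x ∨ z = x ∨ y = z := by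
  constructor
  · intro h x y z hy hz
    have hb := h _ (Setoid.mem_classes α.rel x)
    by_contra! hne
    have : 2 < {w | α.rel w x}.ncard := (Set.two_lt_ncard_iff (Set.toFinite _)).2
      ⟨x, y, z, α.rel.refl' x, α.rel.symm' hy, α.rel.symm' hz, hne.1.symm, hne.2.1.symm, hne.2.2⟩
    omega
  · rintro h _ ⟨x, rfl⟩
    by_contra! hlt
    obtain ⟨a, b, c, ha, hb, hc, h1, h2, h3⟩ :=
      (Set.two_lt_ncard_iff (Set.toFinite _)).1 hlt
    rcases h a b c (α.rel.trans' ha (α.rel.symm' hb)) (α.rel.trans' ha (α.rel.symm' hc))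
      with e | e | e
    exacts [h1 e.symm, h2 e.symm, h3 e]

theorem ofPerm_blocks (σ : Equiv.Perm (Fin n)) :
    ∀ b ∈ (ofPerm σ).blocks, b.ncard ≤ 2 := by
  rw [blocks_ncard_le_two_iff]
  rintro x y z hy hz
  have hy' : Sum.elim σ id x = Sum.elim σ id y := hy
  have hz' : Sum.elim σ id x = Sum.elim σ id z := hz
  rcases x with x | x <;> rcases y with y | y <;> rcases z with z | z <;>
    simp at hy' hz' ⊢ <;> simp_all

theorem mul_blocks (α β : PartitionMonoid n) (hα : ∀ b ∈ α.blocks, b.ncard ≤ 2)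
    (hβ : ∀ b ∈ β.blocks, b.ncard ≤ 2) : ∀ b ∈ (α * β).blocks, b.ncard ≤ 2 := by
  rw [blocks_ncard_le_two_iff] at hα hβ ⊢
  have haux : ∀ (r : Setoid (Fin n ⊕ Fin n)) (f : Fin n ⊕ Fin n → Fin n ⊕ (Fin n ⊕ Fin n)),
      Function.Injective f → (∀ x y z, r x y → r x z → y = x ∨ z = x ∨ y = z) →
      ∀ x y z, r.map f x y → r.map f x z → y = x ∨ z = x ∨ y = z := by
    intro r f hf h x y z hy hz
    rw [SetoidAux.map_iff _ _ hf] at hy hz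
    rcases hy with rfl | ⟨a, b, hab, rfl, rfl⟩
    · exact Or.inl rfl
    · rcases hz with rfl | ⟨a', c, hac, e, rfl⟩
      · exact Or.inr (Or.inl rfl)
      · obtain rfl := hf e
        rcases h _ _ _ hab hac with e | e | e <;> simp [e]
  obtain ⟨A, hA1, hA2, hA3⟩ := SetoidAux.exists_involution _ (haux _ _ upper_injective hα)
  obtain ⟨B, hB1, hB2, hB3⟩ := SetoidAux.exists_involution _ (haux _ _ lower_injective hβ)
  have hBfix : ∀ i, B (Sum.inl i) = Sum.inl i := by
    intro i
    rcases (SetoidAux.map_iff _ _ lower_injective _ _).1 (hB2 (Sum.inl i)) with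
      e | ⟨a, b, -, e, -⟩
    · exact e.symm
    · cases e
  have hAfix : ∀ i, A (Sum.inr (Sum.inr i)) = Sum.inr (Sum.inr i) := by
    intro i
    rcases (SetoidAux.map_iff _ _ upper_injective _ _).1 (hA2 (Sum.inr (Sum.inr i))) with
      e | ⟨a | a, b, -, e, -⟩
    · exact e.symm
    · cases e
    · cases e
  have hfix : ∀ x, A (outer n x) = outer n x ∨ B (outer n x) = outer n x := by
    rintro (i | i)
    · exact Or.inr (hBfix i)
    · exact Or.inl (hAfix i)
  intro x y z hy hz
  change joint α β (outer n x) (outer n y) at hy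
  change joint α β (outer n x) (outer n z) at hz
  have key : outer n y = outer n x ∨ outer n z = outer n x ∨ outer n y = outer n z := by
    rcases hfix x with hx | hx
    · rw [joint, sup_comm] at hy hz
      exact SetoidAux.three_of_fixed _ _ B A hB1 hA1 hB3 hA3 _ _ _ hx (hfix y).symm
        (hfix z).symm hy hz
    · exact SetoidAux.three_of_fixed _ _ A B hA1 hB1 hA3 hB3 _ _ _ hx (hfix y)
        (hfix z) hy hz
  simpa only [outer_injective.eq_iff] using key

end PartitionMonoid

/-! ## The partial Brauer monoid -/

/-- The partial Brauer monoid of degree `n`: the partitions of degree `n` all of whose blocks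
have size at most `2`. -/
def PartialBrauer (n : ℕ) : Submonoid (PartitionMonoid n) where
  carrier := {α | ∀ b ∈ α.blocks, b.ncard ≤ 2}
  one_mem' := PartitionMonoid.ofPerm_blocks 1
  mul_mem' := fun {α β} hα hβ => PartitionMonoid.mul_blocks α β hα hβ

namespace PartialBrauer

/-- The copy in the partial Brauer monoid of the permutation `σ`, with blocks `{i, (σ i)'}`.
Products of partitions correspond to composition of permutations from left to right, while `*`
on `Equiv.Perm` composes from right to left; a set of permutations is a (maximal) subgroup for
one of these multiplications if and only if it is one for the other. -/
def ofPerm {n : ℕ} (σ : Equiv.Perm (Fin n)) : PartialBrauer n :=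
  ⟨PartitionMonoid.ofPerm σ, PartitionMonoid.ofPerm_blocks σ⟩

/-- The symmetric group inside the partial Brauer monoid. -/
def symmetricGroup (n : ℕ) : Set (PartialBrauer n) := Set.range ofPerm

/-- `(PBₙ \ Sₙ) ∪ U`, for a subgroup `U` of the symmetric group. -/
def adjoinSubgroup {n : ℕ} (U : Subgroup (Equiv.Perm (Fin n))) : Set (PartialBrauer n) :=
  (Set.univ \ symmetricGroup n) ∪ ofPerm '' (U : Set (Equiv.Perm (Fin n)))

/-- `PBₙ \ {α : rank α = n - 1}` (used for `n ≥ 1`). -/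
def removeRank (n : ℕ) : Set (PartialBrauer n) :=
  Set.univ \ {α | α.1.rank = n - 1}

/-- `PBₙ \ {α : rank α = n - 2 and ker α is non-trivial}` (used for `n ≥ 2`). -/
def removeKer (n : ℕ) : Set (PartialBrauer n) :=
  Set.univ \ {α | α.1.rank = n - 2 ∧ α.1.ker ≠ ⊥}

/-- `PBₙ \ {α : rank α = n - 2 and coker α is non-trivial}` (used for `n ≥ 2`). -/
def removeCoker (n : ℕ) : Set (PartialBrauer n) :=
  Set.univ \ {α | α.1.rank = n - 2 ∧ α.1.coker ≠ ⊥}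

end PartialBrauer

/-! Rank does not increase under multiplication, and in `PartialBrauer n` the `𝒥`-classes are
exactly the sets of elements of a given rank (`principalIdeal_eq_iff`). The symmetric group is the
class of rank `n`. A horizontal edge uses up two points of its row, so such edges occur only in rank
at most `n - 2`.

The proof for `n ≥ 2` rests on three facts. Each of the four kinds of listed set is closed under
multiplication: a product of high rank has factors of high rank, and two trivial kernels give a
trivial kernel (`ker_mul_eq_bot`). No listed set is contained in a different one
(`IsListed.eq_of_subset`). Every proper subsemigroup lies in a listed one (`eq_top_of_not_subset`).
By order theory the listed sets are then exactly the maximal subsemigroups.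

The third fact is a statement about generation, `partialBrauer_le`. A subsemigroup inside no listed
set contains all permutations, an element of rank `n - 1`, and elements of rank `n - 2` with
non-trivial kernel and with non-trivial cokernel. Permutations and rank `n - 1` give all partial
identities `isolate S`. With these, the two elements of rank `n - 2` can be trimmed to a single
upper edge and a single lower edge, whose product is a `hook`. Finally, every diagram arises from a
restricted permutation by adding horizontal edges one at a time, and adding an edge is
multiplication by a hook (`hook_mul_isolate_mul`, `partialBrauer_induction`). -/

namespace PartitionMonoid

variable {n : ℕ}

/-! ### The joint equivalence relation of two factors. -/

theorem joint_upper {α β : PartitionMonoid n} {x y} (h : α.rel x y) :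
    joint α β (upper n x) (upper n y) :=
  (le_sup_left : _ ≤ joint α β) (Relation.EqvGen.rel _ _ ⟨x, y, h, rfl, rfl⟩)

theorem joint_lower {α β : PartitionMonoid n} {x y} (h : β.rel x y) :
    joint α β (lower n x) (lower n y) :=
  (le_sup_right : _ ≤ joint α β) (Relation.EqvGen.rel _ _ ⟨x, y, h, rfl, rfl⟩)

theorem joint_le {α β : PartitionMonoid n} {s : Setoid (Fin n ⊕ (Fin n ⊕ Fin n))}
    (h₁ : ∀ x y, α.rel x y → s (upper n x) (upper n y))
    (h₂ : ∀ x y, β.rel x y → s (lower n x) (lower n y)) : joint α β ≤ s :=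
  sup_le ((SetoidAux.map_le_iff _ _ _).2 fun x y h => h₁ x y h)
    ((SetoidAux.map_le_iff _ _ _).2 fun x y h => h₂ x y h)

/-- A set of points of the three rows that is saturated for both factors is saturated for the
joint equivalence relation. -/
theorem joint_mem {α β : PartitionMonoid n} (K : Set (Fin n ⊕ (Fin n ⊕ Fin n)))
    (h₁ : ∀ x y, α.rel x y → upper n x ∈ K → upper n y ∈ K)
    (h₂ : ∀ x y, β.rel x y → lower n x ∈ K → lower n y ∈ K) {x y} (h : joint α β x y)
    (hx : x ∈ K) : y ∈ K := by
  have hle : joint α β ≤ Setoid.ker (fun u => u ∈ K) := joint_le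
    (fun x y h => propext ⟨h₁ x y h, h₁ y x (α.rel.symm' h)⟩)
    (fun x y h => propext ⟨h₂ x y h, h₂ y x (β.rel.symm' h)⟩)
  exact (show (x ∈ K) = (y ∈ K) from hle h).mp hx

/-! ### The involution -/

theorem star_rel (α : PartitionMonoid n) (x y) : α.star.rel x y ↔ α.rel x.swap y.swap := Iff.rfl

@[simp] theorem star_star (α : PartitionMonoid n) : α.star.star = α := by
  ext x y
  simp [star_rel]

theorem coker_star (α : PartitionMonoid n) : α.star.coker = α.ker := by
  rw [coker, star_star]

/-- The map `f` turns the three-row diagram upside down and so exchanges the roles of the two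
factors. One inclusion suffices, since the involution applied to it yields the other. -/
theorem star_mul_le (α β : PartitionMonoid n) : (α * β).star.rel ≤ (β.star * α.star).rel := by
  let f : Fin n ⊕ (Fin n ⊕ Fin n) → Fin n ⊕ (Fin n ⊕ Fin n) :=
    Sum.elim (Sum.inr ∘ Sum.inr) (Sum.elim (Sum.inr ∘ Sum.inl) Sum.inl)
  have hu : ∀ x, f (upper n x) = lower n x.swap := by rintro (i | i) <;> rfl
  have hl : ∀ x, f (lower n x) = upper n x.swap := by rintro (i | i) <;> rfl
  have ho : ∀ x, f (outer n x.swap) = outer n x := by rintro (i | i) <;> rfl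
  have hle : joint α β ≤ (joint β.star α.star).comap f := joint_le
    (fun x y h => by
      change joint β.star α.star _ _
      rw [hu, hu]
      exact joint_lower (by rw [star_rel]; simpa using h))
    (fun x y h => by
      change joint β.star α.star _ _
      rw [hl, hl]
      exact joint_upper (by rw [star_rel]; simpa using h))
  intro x y h
  have h' : joint β.star α.star (f (outer n x.swap)) (f (outer n y.swap)) := hle h
  rwa [ho, ho] at h'

theorem star_mul (α β : PartitionMonoid n) : (α * β).star = β.star * α.star := by
  refine PartitionMonoid.ext (le_antisymm (star_mul_le α β) ?_)
  intro x y h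
  have := star_mul_le β.star α.star (x := x.swap) (y := y.swap)
    (by rw [star_rel]; simpa using h)
  rw [star_star, star_star] at this
  exact this

theorem ofPerm_rel_inl_inr (σ : Equiv.Perm (Fin n)) (i j) :
    (ofPerm σ).rel (Sum.inl i) (Sum.inr j) ↔ σ i = j := Iff.rfl

theorem star_ofPerm (σ : Equiv.Perm (Fin n)) : (ofPerm σ).star = ofPerm σ⁻¹ := by
  ext x y
  rw [star_rel]
  change Sum.elim σ id _ = Sum.elim σ id _ ↔ Sum.elim (⇑σ⁻¹) id x = Sum.elim (⇑σ⁻¹) id y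
  rcases x with x | x <;> rcases y with y | y
  · simp
  · exact (Equiv.Perm.inv_eq_iff_eq (f := σ)).symm
  · exact (Equiv.Perm.eq_inv_iff_eq (f := σ)).symm
  · simp

theorem ofPerm_mul_rel (σ : Equiv.Perm (Fin n)) (β : PartitionMonoid n) (x y) :
    (ofPerm σ * β).rel x y ↔ β.rel (x.map σ id) (y.map σ id) := by
  rw [ofPerm_mul]
  rfl

/-- Right-handed rules follow from left-handed ones through the involution, here and below. -/
theorem mul_ofPerm_rel (σ : Equiv.Perm (Fin n)) (β : PartitionMonoid n) (x y) :
    (β * ofPerm σ).rel x y ↔ β.rel (x.map id ⇑σ⁻¹) (y.map id ⇑σ⁻¹) := by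
  have h : β * ofPerm σ = (ofPerm σ⁻¹ * β.star).star := by
    rw [star_mul, star_star, star_ofPerm, inv_inv]
  rw [h, star_rel, ofPerm_mul_rel, star_rel]
  rcases x with x | x <;> rcases y with y | y <;> rfl

/-! ### Partial identities and hooks -/

open Classical in
/-- The partial identity with singleton blocks `{i}` and `{i'}` for `i ∈ S`, and blocks
`{i, i'}` for `i ∉ S`. -/
noncomputable def isolate (S : Set (Fin n)) : PartitionMonoid n :=
  ⟨Setoid.ker (Sum.elim (fun i => if i ∈ S then Sum.inl i else Sum.inr i)
    (Sum.inr : Fin n → Fin n ⊕ Fin n))⟩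

open Classical in
/-- The partition with blocks `{a, b}`, `{a', b'}`, and `{i, i'}` for `i ≠ a, b`. -/
noncomputable def hook (a b : Fin n) : PartitionMonoid n :=
  ⟨Setoid.ker (Sum.elim (fun i => if i = a ∨ i = b then Sum.inl a else Sum.inr i)
    (fun i => if i = a ∨ i = b then Sum.inr a else Sum.inr i : Fin n → Fin n ⊕ Fin n))⟩

theorem isolate_rel_inl_inl (S : Set (Fin n)) (i j) :
    (isolate S).rel (Sum.inl i) (Sum.inl j) ↔ i = j := by
  change Sum.elim _ _ (Sum.inl i) = Sum.elim _ _ (Sum.inl j) ↔ _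
  by_cases hi : i ∈ S <;> by_cases hj : j ∈ S <;> simp [hi, hj]
  · rintro rfl; exact hj hi
  · rintro rfl; exact hi hj

theorem isolate_rel_inl_inr (S : Set (Fin n)) (i j) :
    (isolate S).rel (Sum.inl i) (Sum.inr j) ↔ i = j ∧ i ∉ S := by
  change Sum.elim _ _ (Sum.inl i) = Sum.elim _ _ (Sum.inr j) ↔ _
  by_cases hi : i ∈ S <;> simp [hi]

theorem isolate_rel_inr_inr (S : Set (Fin n)) (i j) :
    (isolate S).rel (Sum.inr i) (Sum.inr j) ↔ i = j := by
  change Sum.elim _ _ (Sum.inr i) = Sum.elim _ _ (Sum.inr j) ↔ _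
  simp

theorem isolate_rel_inr_inl (S : Set (Fin n)) (i j) :
    (isolate S).rel (Sum.inr i) (Sum.inl j) ↔ i = j ∧ i ∉ S := by
  rw [Setoid.comm', isolate_rel_inl_inr]
  constructor <;> (rintro ⟨rfl, h⟩; exact ⟨rfl, h⟩)

theorem hook_rel_inl_inl (a b i j : Fin n) :
    (hook a b).rel (Sum.inl i) (Sum.inl j) ↔ i = j ∨ ((i = a ∨ i = b) ∧ (j = a ∨ j = b)) := by
  change Sum.elim _ _ (Sum.inl i) = Sum.elim _ _ (Sum.inl j) ↔ _
  by_cases hi : i = a ∨ i = b <;> by_cases hj : j = a ∨ j = b <;> simp [hi, hj]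
  · rintro rfl; exact hj hi
  · rintro rfl; exact hi hj

theorem hook_rel_inr_inr (a b i j : Fin n) :
    (hook a b).rel (Sum.inr i) (Sum.inr j) ↔ i = j ∨ ((i = a ∨ i = b) ∧ (j = a ∨ j = b)) := by
  change Sum.elim _ _ (Sum.inr i) = Sum.elim _ _ (Sum.inr j) ↔ _
  by_cases hi : i = a ∨ i = b <;> by_cases hj : j = a ∨ j = b <;> simp [hi, hj]
  · constructor
    · rintro rfl; simp at hj
    · rintro rfl; exact absurd hi hj
  · constructor
    · rintro rfl; simp at hi
    · rintro rfl; exact absurd hj hi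

theorem hook_rel_inl_inr (a b i j : Fin n) :
    (hook a b).rel (Sum.inl i) (Sum.inr j) ↔ i = j ∧ ¬ (i = a ∨ i = b) := by
  change Sum.elim _ _ (Sum.inl i) = Sum.elim _ _ (Sum.inr j) ↔ _
  by_cases hi : i = a ∨ i = b <;> by_cases hj : j = a ∨ j = b <;> simp [hi, hj]
  · constructor
    · rintro rfl; simp at hi
    · rintro rfl; exact absurd hj hi

theorem hook_rel_inr_inl (a b i j : Fin n) :
    (hook a b).rel (Sum.inr i) (Sum.inl j) ↔ i = j ∧ ¬ (i = a ∨ i = b) := by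
  rw [Setoid.comm', hook_rel_inl_inr]
  constructor <;> (rintro ⟨rfl, h⟩; exact ⟨rfl, h⟩)

theorem star_isolate (S : Set (Fin n)) : (isolate S).star = isolate S := by
  ext x y
  rw [star_rel]
  rcases x with x | x <;> rcases y with y | y <;>
    simp [isolate_rel_inl_inl, isolate_rel_inl_inr, isolate_rel_inr_inr, isolate_rel_inr_inl]

theorem star_hook (a b : Fin n) : (hook a b).star = hook a b := by
  ext x y
  rw [star_rel]
  rcases x with x | x <;> rcases y with y | y <;>
    simp [hook_rel_inl_inl, hook_rel_inl_inr, hook_rel_inr_inr, hook_rel_inr_inl]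

theorem isolate_empty : isolate (∅ : Set (Fin n)) = 1 := by
  change _ = ofPerm 1
  ext x y
  change _ ↔ Sum.elim (⇑(1 : Equiv.Perm (Fin n))) id x = Sum.elim (⇑(1 : Equiv.Perm (Fin n))) id y
  rcases x with x | x <;> rcases y with y | y <;>
    simp [isolate_rel_inl_inl, isolate_rel_inl_inr, isolate_rel_inr_inr, isolate_rel_inr_inl]

/-- Left multiplication by a partial identity isolates points of the upper row. -/
theorem isolate_mul_rel (S : Set (Fin n)) (α : PartitionMonoid n) (x y) :
    (isolate S * α).rel x y ↔
      x = y ∨ (x ∉ Sum.inl '' S ∧ y ∉ Sum.inl '' S ∧ α.rel x y) := by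
  classical
  have hcol : ∀ x, x ∉ Sum.inl '' S → joint (isolate S) α (outer n x) (lower n x) := by
    rintro (i | i) h
    · exact joint_upper (x := Sum.inl i) (y := Sum.inr i)
        ((isolate_rel_inl_inr _ _ _).2 ⟨rfl, fun hi => h ⟨i, hi, rfl⟩⟩)
    · exact Setoid.refl' _ _
  constructor
  · intro h
    -- `p` lowers each upper point outside `S` to the middle row. It is constant on the blocks of
    -- `isolate S` and fixes the lower copy of `α`, so the joint relation is bounded by a pullback
    -- of that copy.
    let p : Fin n ⊕ (Fin n ⊕ Fin n) → Fin n ⊕ (Fin n ⊕ Fin n) :=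
      Sum.elim (fun i => if i ∈ S then Sum.inl i else Sum.inr (Sum.inl i)) Sum.inr
    have hle : joint (isolate S) α ≤ (α.rel.map (lower n)).comap p := by
      refine joint_le ?_ ?_
      · rintro x y h
        suffices p (upper n x) = p (upper n y) by
          change α.rel.map (lower n) _ _
          rw [this]
        rcases x with x | x <;> rcases y with y | y
        · rw [isolate_rel_inl_inl] at h; rw [h]
        · rw [isolate_rel_inl_inr] at h
          obtain ⟨rfl, h⟩ := h
          simp [p, upper, h]
        · rw [isolate_rel_inr_inl] at h
          obtain ⟨rfl, h⟩ := h
          simp [p, upper, h]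
        · rw [isolate_rel_inr_inr] at h; rw [h]
      · intro x y h
        exact (SetoidAux.map_iff _ _ lower_injective _ _).2 (Or.inr ⟨x, y, h, rfl, rfl⟩)
    have h' : α.rel.map (lower n) (p (outer n x)) (p (outer n y)) := hle h
    rw [SetoidAux.map_iff _ _ lower_injective] at h'
    rcases h' with h' | ⟨a, b, hab, hx, hy⟩
    · left
      rcases x with x | x <;> rcases y with y | y <;> simp only [p, outer, Sum.map_inl,
        Sum.map_inr, Sum.elim_inl, Sum.elim_inr, id] at h'
      · split_ifs at h' <;> simpa using h'
      · split_ifs at h' <;> simp at h'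
      · split_ifs at h' <;> simp at h'
      · simpa using h'
    · right
      have key : ∀ x c, lower n c = p (outer n x) → x ∉ Sum.inl '' S ∧ c = x := by
        rintro (x | x) c hc <;> simp only [p, outer, lower, Sum.map_inl,
          Sum.map_inr, Sum.elim_inl, Sum.elim_inr, id] at hc
        · split_ifs at hc with hS
          simpa [hS] using hc
        · simpa using hc
      obtain ⟨h1, rfl⟩ := key x a hx
      obtain ⟨h2, rfl⟩ := key y b hy
      exact ⟨h1, h2, hab⟩
  · rintro (rfl | ⟨hx, hy, h⟩)
    · exact Setoid.refl' _ _
    · exact (joint _ α).trans' (hcol x hx) ((joint _ α).trans' (joint_lower h)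
        ((joint _ α).symm' (hcol y hy)))

theorem mul_isolate_rel (S : Set (Fin n)) (α : PartitionMonoid n) (x y) :
    (α * isolate S).rel x y ↔
      x = y ∨ (x ∉ Sum.inr '' S ∧ y ∉ Sum.inr '' S ∧ α.rel x y) := by
  have h : α * isolate S = (isolate S * α.star).star := by
    rw [star_mul, star_star, star_isolate]
  rw [h, star_rel, isolate_mul_rel, star_rel]
  rcases x with x | x <;> rcases y with y | y <;> simp

theorem isolate_mul_isolate (S T : Set (Fin n)) : isolate S * isolate T = isolate (S ∪ T) := by
  ext x y
  rw [isolate_mul_rel]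
  rcases x with x | x <;> rcases y with y | y <;>
    simp [isolate_rel_inl_inl, isolate_rel_inl_inr, isolate_rel_inr_inr, isolate_rel_inr_inl]
  · tauto
  · constructor
    · rintro ⟨h, rfl, h'⟩; exact ⟨rfl, h, h'⟩
    · rintro ⟨rfl, h, h'⟩; exact ⟨h, rfl, h'⟩

/-- Left multiplication by a hook joins two singleton blocks of the upper row. -/
theorem hook_mul_rel (a b : Fin n) (α : PartitionMonoid n)
    (ha : ∀ y, α.rel (Sum.inl a) y → y = Sum.inl a)
    (hb : ∀ y, α.rel (Sum.inl b) y → y = Sum.inl b) (x y) :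
    (hook a b * α).rel x y ↔
      α.rel x y ∨ ((x = Sum.inl a ∨ x = Sum.inl b) ∧ (y = Sum.inl a ∨ y = Sum.inl b)) := by
  classical
  have hcol : ∀ x, x ≠ Sum.inl a → x ≠ Sum.inl b → joint (hook a b) α (outer n x) (lower n x) := by
    rintro (i | i) h h'
    · exact joint_upper (x := Sum.inl i) (y := Sum.inr i)
        ((hook_rel_inl_inr _ _ _ _).2 ⟨rfl, by rintro (rfl | rfl) <;> simp at h h'⟩)
    · exact Setoid.refl' _ _
  constructor
  · intro h
    -- Besides lowering upper points other than `a`, `b`, this `p` merges the upper pair `a`, `b`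
    -- into one point outside the image of `lower`, and merges the middle pair as well.
    let p : Fin n ⊕ (Fin n ⊕ Fin n) → Fin n ⊕ (Fin n ⊕ Fin n) :=
      Sum.elim (fun i => if i = a ∨ i = b then Sum.inl a else Sum.inr (Sum.inl i))
        (Sum.elim (fun i => if i = a ∨ i = b then Sum.inr (Sum.inl a) else Sum.inr (Sum.inl i))
          (Sum.inr ∘ Sum.inr))
    have hle : joint (hook a b) α ≤ (α.rel.map (lower n)).comap p := by
      refine joint_le ?_ ?_
      · rintro x y h
        suffices p (upper n x) = p (upper n y) by
          change α.rel.map (lower n) _ _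
          rw [this]
        rcases x with x | x <;> rcases y with y | y
        · rw [hook_rel_inl_inl] at h
          rcases h with rfl | ⟨h, h'⟩
          · rfl
          · simp [p, upper, h, h']
        · rw [hook_rel_inl_inr] at h
          obtain ⟨rfl, h⟩ := h
          simp [p, upper, h]
        · rw [hook_rel_inr_inl] at h
          obtain ⟨rfl, h⟩ := h
          simp [p, upper, h]
        · rw [hook_rel_inr_inr] at h
          rcases h with rfl | ⟨h, h'⟩
          · rfl
          · simp [p, upper, h, h']
      · intro x y h
        change α.rel.map (lower n) _ _
        by_cases hxy : x = y
        · rw [hxy]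
        -- By `ha` and `hb` the points `a` and `b` are singleton blocks of `α`, so merging their
        -- middle copies does not disturb any pair of distinct related points.
        have hx : ∀ {u v}, α.rel u v → u ≠ v → p (lower n u) = lower n u := by
          rintro (u | u) v huv hne
          · have : ¬ (u = a ∨ u = b) := by
              rintro (rfl | rfl)
              exacts [hne (ha _ huv).symm, hne (hb _ huv).symm]
            simp [p, lower, this]
          · rfl
        rw [hx h hxy, hx (Setoid.symm' _ h) (Ne.symm hxy)]
        exact (SetoidAux.map_iff _ _ lower_injective _ _).2 (Or.inr ⟨x, y, h, rfl, rfl⟩)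
    have h' : α.rel.map (lower n) (p (outer n x)) (p (outer n y)) := hle h
    rw [SetoidAux.map_iff _ _ lower_injective] at h'
    rcases h' with h' | ⟨c, d, hcd, hx, hy⟩
    · rcases x with x | x <;> rcases y with y | y <;> simp only [p, outer, Sum.map_inl,
        Sum.map_inr, Sum.elim_inl, Sum.elim_inr, id, Function.comp] at h'
      · split_ifs at h' with h1 h2 h2
        · right; simpa using ⟨h1, h2⟩
        · left
          obtain rfl : x = y := by simpa using h'
          exact Setoid.refl' _ _
      · split_ifs at h' <;> simp at h'
      · split_ifs at h' <;> simp at h'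
      · left
        obtain rfl : x = y := by simpa using h'
        exact Setoid.refl' _ _
    · left
      have key : ∀ x c, lower n c = p (outer n x) → c = x := by
        rintro (x | x) c hc <;> simp only [p, outer, lower, Sum.map_inl,
          Sum.map_inr, Sum.elim_inl, Sum.elim_inr, id, Function.comp] at hc
        · split_ifs at hc with hS
          simpa using hc
        · simpa using hc
      obtain rfl := key x c hx
      obtain rfl := key y d hy
      exact hcd
  · rintro (h | ⟨hx, hy⟩)
    · by_cases hxy : x = y
      · rw [hxy]
      have hne : ∀ {u v}, α.rel u v → u ≠ v → u ≠ Sum.inl a ∧ u ≠ Sum.inl b := by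
        intro u v huv hne
        constructor <;> rintro rfl
        exacts [hne (ha _ huv).symm, hne (hb _ huv).symm]
      have h1 := hne h hxy
      have h2 := hne (Setoid.symm' _ h) (Ne.symm hxy)
      exact (joint _ α).trans' (hcol x h1.1 h1.2) ((joint _ α).trans' (joint_lower h)
        ((joint _ α).symm' (hcol y h2.1 h2.2)))
    · have : (hook a b).rel x y := by
        rcases hx with rfl | rfl <;> rcases hy with rfl | rfl <;> simp [hook_rel_inl_inl]
      have h' := joint_upper (β := α) this
      rcases hx with rfl | rfl <;> rcases hy with rfl | rfl <;> exact h'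

end PartitionMonoid

namespace PartitionMonoid

variable {n : ℕ}

/-! ### Rank, kernel and domain -/

/-- The points of the upper row that belong to transverse blocks. -/
def dom (α : PartitionMonoid n) : Set (Fin n) := {i | ∃ j, α.rel (Sum.inl i) (Sum.inr j)}

theorem mem_partialBrauer_iff {α : PartitionMonoid n} :
    α ∈ PartialBrauer n ↔ ∀ x y z, α.rel x y → α.rel x z → y = x ∨ z = x ∨ y = z :=
  blocks_ncard_le_two_iff α

theorem eq_of_rel {α : PartitionMonoid n} (h : α ∈ PartialBrauer n) {x y z} (hy : α.rel x y)
    (hz : α.rel x z) (hyx : y ≠ x) (hzx : z ≠ x) : y = z :=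
  ((mem_partialBrauer_iff.1 h x y z hy hz).resolve_left hyx).resolve_left hzx

theorem star_mem {α : PartitionMonoid n} (h : α ∈ PartialBrauer n) :
    α.star ∈ PartialBrauer n := by
  rw [mem_partialBrauer_iff] at h ⊢
  intro x y z hy hz
  simpa only [Sum.swap_leftInverse.injective.eq_iff] using h _ _ _ hy hz

theorem ker_eq_bot_iff {α : PartitionMonoid n} :
    α.ker = ⊥ ↔ ∀ i j, α.rel (Sum.inl i) (Sum.inl j) → i = j :=
  ⟨fun h i j hij => by
      have : α.ker i j := hij
      rwa [h] at this,
    fun h => le_bot_iff.1 fun {i j} hij => h i j hij⟩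

theorem ker_ne_bot_iff {α : PartitionMonoid n} :
    α.ker ≠ ⊥ ↔ ∃ a b, a ≠ b ∧ α.rel (Sum.inl a) (Sum.inl b) := by
  rw [ne_eq, ker_eq_bot_iff]
  push Not
  exact exists_congr fun a => exists_congr fun b => and_comm

theorem coker_eq_bot_iff {α : PartitionMonoid n} :
    α.coker = ⊥ ↔ ∀ i j, α.rel (Sum.inr i) (Sum.inr j) → i = j :=
  ker_eq_bot_iff (α := α.star)

/-- A transverse block has only one upper point, as two upper points and a lower one would make
three. -/
theorem rank_eq_ncard_dom {α : PartitionMonoid n} (h : α ∈ PartialBrauer n) :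
    α.rank = α.dom.ncard := by
  have himg : {b | b ∈ α.blocks ∧ IsTransverse b} =
      (fun i => {w | α.rel w (Sum.inl i)}) '' α.dom := by
    ext b
    constructor
    · rintro ⟨⟨x, rfl⟩, ⟨i, hi⟩, ⟨j, hj⟩⟩
      have hi' : α.rel (Sum.inl i) x := hi
      have hj' : α.rel (Sum.inr j) x := hj
      refine ⟨i, ⟨j, α.rel.trans' hi' (α.rel.symm' hj')⟩, ?_⟩
      ext w
      exact ⟨fun hw => α.rel.trans' hw hi', fun hw => α.rel.trans' hw (α.rel.symm' hi')⟩
    · rintro ⟨i, ⟨j, hj⟩, rfl⟩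
      exact ⟨⟨_, rfl⟩, ⟨i, α.rel.refl' _⟩, ⟨j, α.rel.symm' hj⟩⟩
  rw [rank, himg]
  refine Set.InjOn.ncard_image ?_
  rintro i ⟨j, hj⟩ k - hik
  have hmem : Sum.inl i ∈ {w | α.rel w (Sum.inl i)} := α.rel.refl' _
  change {w | α.rel w (Sum.inl i)} = {w | α.rel w (Sum.inl k)} at hik
  rw [hik] at hmem
  have hmem' : α.rel (Sum.inl i) (Sum.inl k) := hmem
  by_contra hne
  have := eq_of_rel h hj hmem' (by simp) (by simpa using Ne.symm hne)
  simp at this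

theorem rank_star (α : PartitionMonoid n) : α.star.rank = α.rank := by
  have himg : {b | b ∈ α.star.blocks ∧ IsTransverse b} =
      (fun b : Set (Fin n ⊕ Fin n) => Sum.swap '' b) '' {b | b ∈ α.blocks ∧ IsTransverse b} := by
    ext b
    constructor
    · rintro ⟨⟨x, rfl⟩, ⟨i, hi⟩, ⟨j, hj⟩⟩
      refine ⟨{w | α.rel w x.swap}, ⟨⟨_, rfl⟩, ⟨j, hj⟩, ⟨i, hi⟩⟩, ?_⟩
      ext (w | w) <;> simp [star_rel]
    · rintro ⟨_, ⟨⟨x, rfl⟩, ⟨i, hi⟩, ⟨j, hj⟩⟩, rfl⟩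
      refine ⟨⟨x.swap, ?_⟩, ⟨j, ⟨_, hj, rfl⟩⟩, ⟨i, ⟨_, hi, rfl⟩⟩⟩
      ext (w | w) <;> simp [star_rel]
  rw [rank, himg, rank]
  refine Set.ncard_image_of_injective _ (Set.image_injective.2 ?_)
  exact Function.Involutive.injective Sum.swap_swap

/-- The `α`-block of a point outside `α.dom` stays in the top row, which `β` does not touch. It is
therefore saturated and never reaches the bottom row. -/
theorem dom_mul_subset (α β : PartitionMonoid n) : (α * β).dom ⊆ α.dom := by
  rintro i ⟨j, hj⟩
  by_contra hi
  have hi' : ∀ k, ¬ α.rel (Sum.inl i) (Sum.inr k) := fun k hk => hi ⟨k, hk⟩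
  obtain ⟨k, -, hk⟩ := joint_mem (Sum.inl '' {k | α.rel (Sum.inl i) (Sum.inl k)}) (α := α) (β := β)
    (by
      rintro (x | x) (y | y) h ⟨k, hk, hkx⟩ <;> simp [upper] at hkx
      · subst hkx
        exact ⟨y, α.rel.trans' hk h, rfl⟩
      · subst hkx
        exact absurd (α.rel.trans' hk h) (hi' y))
    (by
      rintro x y h ⟨k, hk, hkx⟩
      simp [lower] at hkx) hj ⟨i, α.rel.refl' _, rfl⟩
  simp [outer] at hk

theorem rank_mul_le_left {α β : PartitionMonoid n} (hα : α ∈ PartialBrauer n)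
    (hβ : β ∈ PartialBrauer n) : (α * β).rank ≤ α.rank := by
  rw [rank_eq_ncard_dom hα, rank_eq_ncard_dom (mul_mem hα hβ)]
  exact Set.ncard_le_ncard (dom_mul_subset α β) (Set.toFinite _)

theorem rank_mul_le_right {α β : PartitionMonoid n} (hα : α ∈ PartialBrauer n)
    (hβ : β ∈ PartialBrauer n) : (α * β).rank ≤ β.rank := by
  rw [← rank_star, star_mul, ← rank_star β]
  exact rank_mul_le_left (star_mem hβ) (star_mem hα)

theorem ker_le_ker_mul (α β : PartitionMonoid n) : α.ker ≤ (α * β).ker :=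
  fun {i j} h => joint_upper (x := Sum.inl i) (y := Sum.inl j) h

/-- From a top point `a` one passes through `α` to middle points and from these through `β` to
bottom points. Trivial kernels prevent any further spreading, so these points together with `a` form
a saturated set whose only top point is `a`. The cokernels and the block sizes play no role. -/
theorem ker_mul_eq_bot {α β : PartitionMonoid n} (hkα : α.ker = ⊥) (hkβ : β.ker = ⊥) :
    (α * β).ker = ⊥ := by
  rw [ker_eq_bot_iff] at hkα hkβ ⊢
  intro a b hab
  have := joint_mem ({w | w = Sum.inl a ∨ (∃ c, w = Sum.inr (Sum.inl c) ∧
    α.rel (Sum.inl a) (Sum.inr c)) ∨ ∃ d, w = Sum.inr (Sum.inr d) ∧ ∃ c,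
      α.rel (Sum.inl a) (Sum.inr c) ∧ β.rel (Sum.inl c) (Sum.inr d)}) (α := α) (β := β)
    (by
      rintro (x | x) (y | y) h hx <;> simp [upper] at hx ⊢
      · subst hx
        exact (hkα _ _ h).symm
      · subst hx
        exact h
      · exact (hkα _ _ (α.rel.trans' hx h)).symm
      · exact α.rel.trans' hx h)
    (by
      rintro (x | x) (y | y) h hx <;> simp [lower] at hx ⊢
      · rwa [← hkβ _ _ h]
      · exact ⟨x, hx, h⟩
      · obtain ⟨c, hc, hcx⟩ := hx
        rwa [← hkβ _ _ (β.rel.trans' hcx h)]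
      · obtain ⟨c, hc, hcx⟩ := hx
        exact ⟨c, hc, β.rel.trans' hcx h⟩) hab (Or.inl rfl)
  simpa [outer, eq_comm] using this

theorem dom_isolate (S : Set (Fin n)) : (isolate S).dom = Sᶜ := by
  ext i
  simp [dom, isolate_rel_inl_inr]

theorem isolate_mem (S : Set (Fin n)) : isolate S ∈ PartialBrauer n := by
  rw [mem_partialBrauer_iff]
  rintro (x | x) (y | y) (z | z) hy hz <;>
    simp [isolate_rel_inl_inl, isolate_rel_inl_inr, isolate_rel_inr_inr,
      isolate_rel_inr_inl] at hy hz ⊢ <;> simp_all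

theorem hook_mem (a b : Fin n) : hook a b ∈ PartialBrauer n := by
  rw [mem_partialBrauer_iff]
  rintro (x | x) (y | y) (z | z) hy hz <;>
    simp [hook_rel_inl_inl, hook_rel_inl_inr, hook_rel_inr_inr,
      hook_rel_inr_inl] at hy hz ⊢ <;> grind

theorem ofPerm_mem (σ : Equiv.Perm (Fin n)) : ofPerm σ ∈ PartialBrauer n := ofPerm_blocks σ

theorem rank_isolate (S : Set (Fin n)) : (isolate S).rank = Sᶜ.ncard := by
  rw [rank_eq_ncard_dom (isolate_mem S), dom_isolate]

theorem rank_le (α : PartitionMonoid n) (hα : α ∈ PartialBrauer n) : α.rank ≤ n := by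
  rw [rank_eq_ncard_dom hα]
  simpa using Set.ncard_le_card α.dom

theorem notMem_dom {α : PartitionMonoid n} (hα : α ∈ PartialBrauer n) {a b : Fin n}
    (hab : a ≠ b) (h : α.rel (Sum.inl a) (Sum.inl b)) : a ∉ α.dom := by
  rintro ⟨j, hj⟩
  have := eq_of_rel hα h hj (by simpa using hab.symm) (by simp)
  simp at this

/-- Both ends of an upper edge lie outside the domain. Hence diagrams of rank `n` and `n - 1` have
no horizontal edges. -/
theorem rank_add_two_le {α : PartitionMonoid n} (hα : α ∈ PartialBrauer n)
    (h : α.ker ≠ ⊥) : α.rank + 2 ≤ n := by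
  obtain ⟨a, b, hab, h⟩ := ker_ne_bot_iff.1 h
  have hsub : ({a, b} : Set (Fin n)) ⊆ α.domᶜ := by
    rintro i (rfl | rfl)
    · exact notMem_dom hα hab h
    · exact notMem_dom hα hab.symm (α.rel.symm' h)
  have := Set.ncard_le_ncard hsub (Set.toFinite _)
  have h2 := Set.ncard_add_ncard_compl α.dom
  rw [Set.ncard_pair hab] at this
  rw [Nat.card_fin] at h2
  rw [rank_eq_ncard_dom hα]
  omega

/-! ### Decomposition of diagrams into restricted permutations and horizontal edges. -/

/-- A partition without horizontal edges is a restriction of a permutation. -/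
theorem exists_isolate_mul_ofPerm {α : PartitionMonoid n}
    (hk : α.ker = ⊥) (hc : α.coker = ⊥) :
    ∃ σ : Equiv.Perm (Fin n), α = isolate α.domᶜ * ofPerm σ := by
  classical
  rw [ker_eq_bot_iff] at hk
  rw [coker_eq_bot_iff] at hc
  choose! f hf using fun i (hi : i ∈ α.dom) => hi
  have hinj : Set.InjOn f α.dom := by
    intro i hi j hj hij
    refine hk i j (α.rel.trans' (hf i hi) ?_)
    rw [hij]
    exact α.rel.symm' (hf j hj)
  -- The partial injection `f` is completed to a permutation. The values off `α.dom` are arbitrary,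
  -- since `isolate α.domᶜ` cuts those points off.
  obtain ⟨σ, hσ⟩ : ∃ σ : Equiv.Perm (Fin n), ∀ i ∈ α.dom, σ i = f i := by
    let e : {i // i ∈ α.dom} ≃ {j // j ∈ f '' α.dom} := Equiv.Set.imageOfInjOn f α.dom hinj
    exact ⟨e.extendSubtype, fun i hi => e.extendSubtype_apply_of_mem i hi⟩
  refine ⟨σ, ?_⟩
  have key : ∀ i j, α.rel (Sum.inl i) (Sum.inr j) ↔ i ∈ α.dom ∧ σ i = j := by
    intro i j
    constructor
    · intro h
      have hi : i ∈ α.dom := ⟨j, h⟩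
      exact ⟨hi, by rw [hσ i hi]; exact hc _ _ (α.rel.trans' (α.rel.symm' (hf i hi)) h)⟩
    · rintro ⟨hi, rfl⟩
      rw [hσ i hi]
      exact hf i hi
  ext x y
  rw [isolate_mul_rel]
  rcases x with i | i <;> rcases y with j | j
  · rw [show (ofPerm σ).rel (Sum.inl i) (Sum.inl j) ↔ σ i = σ j from Iff.rfl]
    simp only [Sum.inl.injEq, EmbeddingLike.apply_eq_iff_eq]
    exact ⟨fun h => Or.inl (hk _ _ h), fun h => by
      obtain rfl : i = j := h.elim id fun h => h.2.2
      exact α.rel.refl' _⟩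
  · rw [key, ofPerm_rel_inl_inr]
    simp
  · rw [α.rel.comm', key, (ofPerm σ).rel.comm', ofPerm_rel_inl_inr]
    simp
  · rw [show (ofPerm σ).rel (Sum.inr i) (Sum.inr j) ↔ i = j from Iff.rfl]
    simp only [Sum.inr.injEq]
    exact ⟨fun h => Or.inl (hc _ _ h), fun h => by
      obtain rfl : i = j := h.elim id fun h => h.2.2
      exact α.rel.refl' _⟩

theorem isolate_singleton_mul_rel {α : PartitionMonoid n} {a x y} :
    (isolate {a} * α).rel x y ↔ x = y ∨ (x ≠ Sum.inl a ∧ y ≠ Sum.inl a ∧ α.rel x y) := by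
  simp [isolate_mul_rel]

/-- Cutting off `a` leaves `b` alone too, as its block was `{a, b}`; the hook joins them again. Thus
an upper edge can be removed and restored by left multiplications, which serves both the generation
argument and the description of `𝒥`. -/
theorem hook_mul_isolate_mul {α : PartitionMonoid n} (hα : α ∈ PartialBrauer n) {a b : Fin n}
    (hab : a ≠ b) (h : α.rel (Sum.inl a) (Sum.inl b)) :
    hook a b * (isolate {a} * α) = α := by
  have h1 : ∀ y, α.rel (Sum.inl b) y → y ≠ Sum.inl a → y = Sum.inl b := by
    intro y hy hya
    by_contra hne
    exact hya (eq_of_rel hα (α.rel.symm' h) hy (by simpa using hab) hne).symm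
  have h2 : ∀ y, α.rel (Sum.inl a) y → y = Sum.inl a ∨ y = Sum.inl b := by
    intro y hy
    by_contra! hne
    exact hne.2 (eq_of_rel hα h hy (by simpa using hab.symm) hne.1).symm
  ext x y
  rw [hook_mul_rel, isolate_singleton_mul_rel]
  · constructor
    · rintro ((rfl | ⟨-, -, h⟩) | ⟨rfl | rfl, rfl | rfl⟩)
      exacts [α.rel.refl' _, h, α.rel.refl' _, h, α.rel.symm' h, α.rel.refl' _]
    · intro hxy
      by_cases hx : x = Sum.inl a
      · subst hx
        exact Or.inr ⟨Or.inl rfl, h2 y hxy⟩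
      by_cases hy : y = Sum.inl a
      · subst hy
        exact Or.inr ⟨h2 x (α.rel.symm' hxy), Or.inl rfl⟩
      exact Or.inl (Or.inr ⟨hx, hy, hxy⟩)
  · intro y
    rw [isolate_singleton_mul_rel]
    rintro (rfl | ⟨h, -⟩)
    exacts [rfl, absurd rfl h]
  · intro y
    rw [isolate_singleton_mul_rel]
    rintro (rfl | ⟨-, h, h'⟩)
    exacts [rfl, h1 y h' h]

theorem mul_isolate_mul_hook {α : PartitionMonoid n} (hα : α ∈ PartialBrauer n) {a b : Fin n}
    (hab : a ≠ b) (h : α.rel (Sum.inr a) (Sum.inr b)) :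
    α * isolate {a} * hook a b = α := by
  have := congrArg star (hook_mul_isolate_mul (star_mem hα) hab h)
  simpa only [star_mul, star_star, star_hook, star_isolate] using this

/-- Removing an edge gives a strictly finer relation; this is the descent in
`partialBrauer_induction`. -/
theorem isolate_mul_rel_lt {α : PartitionMonoid n} {a b : Fin n}
    (hab : a ≠ b) (h : α.rel (Sum.inl a) (Sum.inl b)) : (isolate {a} * α).rel < α.rel := by
  refine lt_of_le_not_ge ?_ fun hle => ?_
  · intro x y hxy
    rw [isolate_singleton_mul_rel] at hxy
    rcases hxy with rfl | ⟨-, -, h⟩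
    exacts [α.rel.refl' _, h]
  · have := hle h
    rw [isolate_singleton_mul_rel] at this
    simp [hab] at this

theorem mul_isolate_rel_lt {α : PartitionMonoid n} {a b : Fin n}
    (hab : a ≠ b) (h : α.rel (Sum.inr a) (Sum.inr b)) : (α * isolate {a}).rel < α.rel := by
  refine lt_of_le_not_ge ?_ fun hle => ?_
  · intro x y hxy
    rw [mul_isolate_rel] at hxy
    rcases hxy with rfl | ⟨-, -, h⟩
    exacts [α.rel.refl' _, h]
  · have := hle h
    rw [mul_isolate_rel] at this
    simp [hab] at this

/-- Induction on partial Brauer diagrams: restrictions of permutations, then adding horizontal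
edges in the upper and the lower row. -/
theorem partialBrauer_induction {P : PartitionMonoid n → Prop}
    (h_base : ∀ (S : Set (Fin n)) σ, P (isolate S * ofPerm σ))
    (h_upper : ∀ α ∈ PartialBrauer n, ∀ a b, a ≠ b → α.rel (Sum.inl a) (Sum.inl b) →
      P (isolate {a} * α) → P α)
    (h_lower : ∀ α ∈ PartialBrauer n, ∀ a b, a ≠ b → α.rel (Sum.inr a) (Sum.inr b) →
      P (α * isolate {a}) → P α)
    (α : PartitionMonoid n) (hα : α ∈ PartialBrauer n) : P α := by
  have : Finite (Setoid (Fin n ⊕ Fin n)) :=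
    Finite.of_injective (fun r x y => r x y) fun r s h => Setoid.ext fun x y => by
      exact iff_of_eq (congrFun (congrFun h x) y)
  have hwf : WellFounded ((· < ·) : Setoid (Fin n ⊕ Fin n) → _ → Prop) := wellFounded_lt
  generalize hr : α.rel = r
  induction r using hwf.induction generalizing α with
  | _ r ih =>
    subst hr
    by_cases hk : α.ker = ⊥
    · by_cases hc : α.coker = ⊥
      · obtain ⟨σ, h⟩ := exists_isolate_mul_ofPerm hk hc
        rw [h]
        exact h_base _ _
      · obtain ⟨a, b, hab, h⟩ := ker_ne_bot_iff.1 hc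
        exact h_lower α hα a b hab h
          (ih _ (mul_isolate_rel_lt hab h) _ (mul_mem hα (isolate_mem _)) rfl)
    · obtain ⟨a, b, hab, h⟩ := ker_ne_bot_iff.1 hk
      exact h_upper α hα a b hab h
        (ih _ (isolate_mul_rel_lt hab h) _ (mul_mem (isolate_mem _) hα) rfl)

end PartitionMonoid

namespace PartitionMonoid

variable {n : ℕ}

/-! ### Generation -/

theorem ofPerm_mul_isolate_mul_ofPerm (σ : Equiv.Perm (Fin n)) (S : Set (Fin n)) :
    ofPerm σ * isolate S * ofPerm σ⁻¹ = isolate (σ ⁻¹' S) := by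
  ext x y
  rw [mul_ofPerm_rel, ofPerm_mul_rel, inv_inv]
  rcases x with x | x <;> rcases y with y | y <;>
    simp [isolate_rel_inl_inl, isolate_rel_inl_inr, isolate_rel_inr_inr, isolate_rel_inr_inl]

theorem ofPerm_mul_hook_mul_ofPerm (σ : Equiv.Perm (Fin n)) (a b : Fin n) :
    ofPerm σ * hook (σ a) (σ b) * ofPerm σ⁻¹ = hook a b := by
  ext x y
  rw [mul_ofPerm_rel, ofPerm_mul_rel, inv_inv]
  rcases x with x | x <;> rcases y with y | y <;>
    simp [hook_rel_inl_inl, hook_rel_inl_inr, hook_rel_inr_inr, hook_rel_inr_inl]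

theorem ofPerm_one : ofPerm (1 : Equiv.Perm (Fin n)) = 1 := rfl

theorem ofPerm_mul_ofPerm_inv (σ : Equiv.Perm (Fin n)) : ofPerm σ * ofPerm σ⁻¹ = 1 := by
  rw [ofPerm_mul_ofPerm, inv_mul_cancel, ofPerm_one]

theorem ofPerm_inv_mul_ofPerm (σ : Equiv.Perm (Fin n)) : ofPerm σ⁻¹ * ofPerm σ = 1 := by
  rw [ofPerm_mul_ofPerm, mul_inv_cancel, ofPerm_one]

theorem ker_eq_bot_of_lt {α : PartitionMonoid n} (hα : α ∈ PartialBrauer n)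
    (h : n < α.rank + 2) : α.ker = ⊥ := by
  by_contra hk
  have := rank_add_two_le hα hk
  omega

theorem coker_eq_bot_of_lt {α : PartitionMonoid n} (hα : α ∈ PartialBrauer n)
    (h : n < α.rank + 2) : α.coker = ⊥ :=
  ker_eq_bot_of_lt (star_mem hα) (by rwa [rank_star])

theorem ncard_compl_dom {α : PartitionMonoid n} (hα : α ∈ PartialBrauer n) :
    α.domᶜ.ncard = n - α.rank := by
  rw [Set.ncard_compl, Nat.card_fin, rank_eq_ncard_dom hα]

theorem exists_ofPerm_of_rank_eq {α : PartitionMonoid n} (hα : α ∈ PartialBrauer n)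
    (h : α.rank = n) : ∃ σ, α = ofPerm σ := by
  obtain ⟨σ, hσ⟩ := exists_isolate_mul_ofPerm (ker_eq_bot_of_lt hα (by omega))
    (coker_eq_bot_of_lt hα (by omega))
  have hd : α.domᶜ = ∅ := by
    rw [← Set.ncard_eq_zero (Set.toFinite _), ncard_compl_dom hα, h, Nat.sub_self]
  refine ⟨σ, ?_⟩
  rw [hσ, hd, isolate_empty, one_mul]

theorem rank_ofPerm (σ : Equiv.Perm (Fin n)) : (ofPerm σ).rank = n := by
  rw [rank_eq_ncard_dom (ofPerm_mem σ)]
  have : (ofPerm σ).dom = Set.univ := Set.eq_univ_of_forall fun i => ⟨σ i, rfl⟩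
  rw [this, Set.ncard_univ, Nat.card_fin]

/-- A diagram of rank `n - 1` has no horizontal edge, so it is `isolate {a}` times a permutation.
Cancelling the permutation, conjugating to move `a`, and multiplying the results gives every partial
identity. -/
theorem isolate_mem_of_rank (T : Subsemigroup (PartitionMonoid n))
    (hperm : ∀ σ, ofPerm σ ∈ T) (hn : 1 ≤ n) {α : PartitionMonoid n} (hαT : α ∈ T)
    (hα : α ∈ PartialBrauer n) (hr : α.rank = n - 1) (S : Set (Fin n)) : isolate S ∈ T := by
  obtain ⟨σ, hσ⟩ := exists_isolate_mul_ofPerm (ker_eq_bot_of_lt hα (by omega))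
    (coker_eq_bot_of_lt hα (by omega))
  obtain ⟨a, ha⟩ := Set.ncard_eq_one.1 (show α.domᶜ.ncard = 1 by
    rw [ncard_compl_dom hα]; omega)
  have haT : isolate {a} ∈ T := by
    have : isolate {a} = α * ofPerm σ⁻¹ := by
      rw [hσ, ha, mul_assoc, ofPerm_mul_ofPerm_inv, mul_one]
    rw [this]
    exact T.mul_mem hαT (hperm _)
  have hsingle : ∀ b, isolate {b} ∈ T := by
    intro b
    have := ofPerm_mul_isolate_mul_ofPerm (Equiv.swap a b) {a}
    have hb : Equiv.swap a b ⁻¹' {a} = {b} := by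
      ext i
      simp [Equiv.swap_apply_eq_iff]
    rw [hb] at this
    rw [← this]
    exact T.mul_mem (T.mul_mem (hperm _) haT) (hperm _)
  induction S, Set.toFinite S using Set.Finite.induction_on with
  | empty => rw [isolate_empty]; exact hperm 1
  | insert _ _ ih =>
    rw [Set.insert_eq, ← isolate_mul_isolate]
    exact T.mul_mem (hsingle _) ih

/-- In rank `n - 2` an upper edge `{a, b}` accounts for all non-transverse upper points. After the
lower non-transverse points are isolated, what remains is `hook a b * isolate {a, b}` times a
permutation, and conjugation moves `a`, `b` to `c`, `d`. -/
theorem hook_mul_isolate_mem (T : Subsemigroup (PartitionMonoid n))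
    (hperm : ∀ σ, ofPerm σ ∈ T) (hiso : ∀ S, isolate S ∈ T) (hn : 2 ≤ n)
    {α : PartitionMonoid n} (hαT : α ∈ T) (hα : α ∈ PartialBrauer n) (hr : α.rank = n - 2)
    (hk : α.ker ≠ ⊥) {c d : Fin n} (hcd : c ≠ d) : hook c d * isolate {c, d} ∈ T := by
  obtain ⟨a, b, hab, h⟩ := ker_ne_bot_iff.1 hk
  have hdom : ({a, b} : Set (Fin n)) = α.domᶜ := by
    refine Set.eq_of_subset_of_ncard_le ?_ ?_ (Set.toFinite _)
    · rintro i (rfl | rfl)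
      · exact notMem_dom hα hab h
      · exact notMem_dom hα hab.symm (α.rel.symm' h)
    · rw [ncard_compl_dom hα, Set.ncard_pair hab]
      omega
  -- `α.star.domᶜ` consists of the lower points in no transverse block, so `β` has no lower edge.
  set β := α * isolate α.star.domᶜ with hβ
  have hβPB : β ∈ PartialBrauer n := mul_mem hα (isolate_mem _)
  have hβab : β.rel (Sum.inl a) (Sum.inl b) := ker_le_ker_mul α _ h
  -- Cutting the single upper edge of `β` leaves a diagram `γ` without horizontal edges, hence a
  -- restricted permutation, and the hook recovers `β` from it.
  have hγ := hook_mul_isolate_mul hβPB hab hβab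
  set γ := isolate {a} * β with hγdef
  have hγPB : γ ∈ PartialBrauer n := mul_mem (isolate_mem _) hβPB
  have hγk : γ.ker = ⊥ := by
    rw [ker_eq_bot_iff]
    intro i j hij
    by_contra hne
    rw [hγdef, isolate_singleton_mul_rel] at hij
    obtain ⟨hi, hj, hij⟩ := hij.resolve_left (by simpa using hne)
    rw [hβ, mul_isolate_rel] at hij
    obtain ⟨-, -, hij⟩ := hij.resolve_left (by simpa using hne)
    have hi' : i ∈ ({a, b} : Set (Fin n)) := hdom ▸ notMem_dom hα hne hij
    have hj' : j ∈ ({a, b} : Set (Fin n)) :=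
      hdom ▸ notMem_dom hα (Ne.symm hne) (α.rel.symm' hij)
    simp at hi hj hi' hj'
    exact hne ((hi'.resolve_left hi).trans (hj'.resolve_left hj).symm)
  have hγc : γ.coker = ⊥ := by
    rw [coker_eq_bot_iff]
    intro i j hij
    by_contra hne
    rw [hγdef, isolate_singleton_mul_rel] at hij
    obtain ⟨-, -, hij⟩ := hij.resolve_left (by simpa using hne)
    rw [hβ, mul_isolate_rel] at hij
    obtain ⟨hi, -, hij⟩ := hij.resolve_left (by simpa using hne)
    exact hi ⟨i, notMem_dom (star_mem hα) hne hij, rfl⟩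
  have hγd : γ.domᶜ = {a, b} := by
    rw [hdom]
    congr 1
    ext i
    constructor
    · rintro ⟨j, hj⟩
      rw [hγdef, isolate_singleton_mul_rel] at hj
      obtain ⟨-, -, hj⟩ := hj.resolve_left (by simp)
      exact dom_mul_subset _ _ ⟨j, hj⟩
    · intro hi
      have hia : i ≠ a := by
        rintro rfl
        exact notMem_dom hα hab h hi
      obtain ⟨j, hj⟩ := hi
      refine ⟨j, ?_⟩
      rw [hγdef, isolate_singleton_mul_rel, hβ, mul_isolate_rel]
      refine Or.inr ⟨by simpa using hia, by simp, Or.inr ⟨by simp, ?_, hj⟩⟩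
      rintro ⟨j', hj', e⟩
      obtain rfl : j' = j := by simpa using e
      exact hj' ⟨i, α.rel.symm' hj⟩
  obtain ⟨σ, hσ⟩ := exists_isolate_mul_ofPerm hγk hγc
  rw [hγd] at hσ
  have habT : hook a b * isolate {a, b} ∈ T := by
    have : hook a b * isolate {a, b} = β * ofPerm σ⁻¹ := by
      rw [← hγ, hσ, mul_assoc, mul_assoc, ofPerm_mul_ofPerm_inv, mul_one]
    rw [this, hβ]
    exact T.mul_mem (T.mul_mem hαT (hiso _)) (hperm _)
  obtain ⟨τ, hτa, hτb⟩ : ∃ τ : Equiv.Perm (Fin n), τ c = a ∧ τ d = b := by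
    -- The first swap sends `c` to `a`; the second sends the image of `d` to `b` and fixes `a`,
    -- which differs from both.
    refine ⟨Equiv.swap (Equiv.swap c a d) b * Equiv.swap c a, ?_, by simp⟩
    rw [Equiv.Perm.mul_apply, Equiv.swap_apply_left]
    refine Equiv.swap_apply_of_ne_of_ne ?_ hab
    intro e
    have : Equiv.swap c a c = Equiv.swap c a d := by rw [← e, Equiv.swap_apply_left]
    exact hcd ((Equiv.swap c a).injective this)
  have h1 := ofPerm_mul_hook_mul_ofPerm τ c d
  have h2 := ofPerm_mul_isolate_mul_ofPerm τ {a, b}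
  have hpre : τ ⁻¹' {a, b} = {c, d} := by
    ext i
    simp [← hτa, ← hτb]
  rw [hτa, hτb] at h1
  rw [hpre] at h2
  have : hook c d * isolate {c, d} = ofPerm τ * (hook a b * isolate {a, b}) * ofPerm τ⁻¹ := by
    calc hook c d * isolate {c, d}
        = ofPerm τ * hook a b * (ofPerm τ⁻¹ * ofPerm τ) * isolate {a, b} * ofPerm τ⁻¹ := by
          rw [← h1, ← h2]; simp only [mul_assoc]
      _ = _ := by rw [ofPerm_inv_mul_ofPerm]; simp only [mul_assoc, one_mul]
  rw [this]
  exact T.mul_mem (T.mul_mem (hperm _) habT) (hperm _)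

/-- The left factor has only an upper edge and the right one only a lower edge; these come from the
non-trivial kernel and cokernel respectively. Before a hook, isolating both ends of its upper edge
has the same effect as isolating one, so the identity reduces to `hook_mul_isolate_mul`. -/
theorem hook_mul_isolate_mul_hook {a b : Fin n} (hab : a ≠ b) :
    hook a b * isolate {a, b} * (isolate {a, b} * hook a b) = hook a b := by
  have h1 : isolate {a} * (isolate {a, b} * hook a b) = isolate {a} * hook a b := by
    have : isolate ({a, b} : Set (Fin n)) * hook a b = isolate {a} * hook a b := by
      ext x y
      rw [isolate_mul_rel, isolate_singleton_mul_rel]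
      rcases x with x | x <;> rcases y with y | y <;>
        simp [hook_rel_inl_inl, hook_rel_inl_inr, hook_rel_inr_inr, hook_rel_inr_inl] <;> grind
    rw [this, ← mul_assoc, isolate_mul_isolate, Set.union_self]
  have h2 : isolate ({a, b} : Set (Fin n)) * (isolate {a, b} * hook a b) =
      isolate {a} * hook a b := by
    rw [← h1, ← mul_assoc, ← mul_assoc, isolate_mul_isolate, isolate_mul_isolate,
      Set.union_self, Set.union_eq_right.2 (by simp)]
  rw [mul_assoc, h2]
  exact hook_mul_isolate_mul (hook_mem a b) hab (by simp [hook_rel_inl_inl])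

/-- The image of a subsemigroup under the involution. -/
def starSubsemigroup (T : Subsemigroup (PartitionMonoid n)) :
    Subsemigroup (PartitionMonoid n) where
  carrier := {α | α.star ∈ T}
  mul_mem' {α β} hα hβ := by
    change (α * β).star ∈ T
    rw [star_mul]
    exact T.mul_mem hβ hα

theorem partialBrauer_le (T : Subsemigroup (PartitionMonoid n)) (hn : 2 ≤ n)
    (hperm : ∀ σ, ofPerm σ ∈ T)
    (h₁ : ∃ α ∈ T, α ∈ PartialBrauer n ∧ α.rank = n - 1)
    (h₂ : ∃ α ∈ T, α ∈ PartialBrauer n ∧ α.rank = n - 2 ∧ α.ker ≠ ⊥)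
    (h₃ : ∃ α ∈ T, α ∈ PartialBrauer n ∧ α.rank = n - 2 ∧ α.coker ≠ ⊥)
    {α : PartitionMonoid n} (hα : α ∈ PartialBrauer n) : α ∈ T := by
  obtain ⟨β₁, hT₁, hβ₁, hr₁⟩ := h₁
  obtain ⟨β₂, hT₂, hβ₂, hr₂, hk₂⟩ := h₂
  obtain ⟨β₃, hT₃, hβ₃, hr₃, hk₃⟩ := h₃
  have hiso := isolate_mem_of_rank T hperm (by omega) hT₁ hβ₁ hr₁
  have hhook : ∀ a b, a ≠ b → hook a b ∈ T := by
    intro a b hab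
    rw [← hook_mul_isolate_mul_hook hab]
    refine T.mul_mem (hook_mul_isolate_mem T hperm hiso hn hT₂ hβ₂ hr₂ hk₂ hab) ?_
    -- The half with the lower edge is obtained by applying the same lemma to the reflected
    -- subsemigroup and the reflected element.
    have := hook_mul_isolate_mem (starSubsemigroup T)
      (fun σ => by
        change (ofPerm σ).star ∈ T
        rw [star_ofPerm]
        exact hperm _)
      (fun S => by
        change (isolate S).star ∈ T
        rw [star_isolate]
        exact hiso S) hn (α := β₃.star)
      (by
        change β₃.star.star ∈ T
        rwa [star_star]) (star_mem hβ₃) (by rwa [rank_star]) hk₃ hab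
    change star _ ∈ T at this
    rwa [star_mul, star_isolate, star_hook] at this
  refine partialBrauer_induction (P := fun α => α ∈ T) ?_ ?_ ?_ α hα
  · exact fun S σ => T.mul_mem (hiso S) (hperm σ)
  · intro α hα a b hab h hT
    rw [← hook_mul_isolate_mul hα hab h]
    exact T.mul_mem (hhook a b hab) hT
  · intro α hα a b hab h hT
    rw [← mul_isolate_mul_hook hα hab h]
    exact T.mul_mem hT (hhook a b hab)

end PartitionMonoid

/-! ## Green's relations -/

theorem principalIdeal_subset {S : Type*} [Monoid S] {x y s t : S} (h : x = s * y * t) :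
    principalIdeal x ⊆ principalIdeal y := by
  have key : ∀ s t, s * y * t ∈ principalIdeal y := fun s t => Or.inr (Or.inr (Or.inr ⟨s, t, rfl⟩))
  subst h
  rintro z (rfl | ⟨u, rfl⟩ | ⟨u, rfl⟩ | ⟨u, v, rfl⟩)
  · exact key s t
  · simpa only [mul_assoc] using key (u * s) t
  · simpa only [mul_assoc] using key s (t * u)
  · simpa only [mul_assoc] using key (u * s) (t * v)

theorem exists_mul_mul_of_principalIdeal_eq {S : Type*} [Monoid S] {x y : S}
    (h : principalIdeal x = principalIdeal y) : ∃ s t, x = s * y * t := by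
  have hx : x ∈ principalIdeal y := h ▸ Or.inl rfl
  rcases hx with rfl | ⟨s, rfl⟩ | ⟨s, rfl⟩ | ⟨s, t, rfl⟩
  exacts [⟨1, 1, by simp⟩, ⟨s, 1, by simp⟩, ⟨1, s, by simp⟩, ⟨s, t, rfl⟩]

theorem exists_mul_of_principalRightIdeal_eq {S : Type*} [Monoid S] {x y : S}
    (h : principalRightIdeal x = principalRightIdeal y) : ∃ t, x = y * t := by
  have hx : x ∈ principalRightIdeal y := h ▸ Or.inl rfl
  rcases hx with rfl | ⟨t, rfl⟩
  exacts [⟨1, by simp⟩, ⟨t, rfl⟩]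

theorem exists_mul_of_principalLeftIdeal_eq {S : Type*} [Monoid S] {x y : S}
    (h : principalLeftIdeal x = principalLeftIdeal y) : ∃ t, x = t * y := by
  have hx : x ∈ principalLeftIdeal y := h ▸ Or.inl rfl
  rcases hx with rfl | ⟨t, rfl⟩
  exacts [⟨1, by simp⟩, ⟨t, rfl⟩]

theorem greenRClass_subset_greenJClass {S : Type*} [Monoid S] (x : S) :
    greenRClass x ⊆ greenJClass x := by
  intro y hy
  obtain ⟨t, ht⟩ := exists_mul_of_principalRightIdeal_eq hy
  obtain ⟨u, hu⟩ := exists_mul_of_principalRightIdeal_eq (Eq.symm hy)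
  exact Set.Subset.antisymm (principalIdeal_subset (s := 1) (t := t) (by rw [one_mul, ← ht]))
    (principalIdeal_subset (s := 1) (t := u) (by rw [one_mul, ← hu]))

theorem greenLClass_subset_greenJClass {S : Type*} [Monoid S] (x : S) :
    greenLClass x ⊆ greenJClass x := by
  intro y hy
  obtain ⟨t, ht⟩ := exists_mul_of_principalLeftIdeal_eq hy
  obtain ⟨u, hu⟩ := exists_mul_of_principalLeftIdeal_eq (Eq.symm hy)
  exact Set.Subset.antisymm (principalIdeal_subset (s := t) (t := 1) (by rw [mul_one, ← ht]))
    (principalIdeal_subset (s := u) (t := 1) (by rw [mul_one, ← hu]))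

/-- The ideals generated by a unit on either side are the whole monoid. -/
theorem one_mem_greenHClass {S : Type*} [Monoid S] {x y : S} (h : x * y = 1) (h' : y * x = 1) :
    (1 : S) ∈ greenHClass x := by
  constructor
  · ext z
    exact ⟨fun _ => Or.inr ⟨z * y, by rw [mul_assoc, h', mul_one]⟩,
      fun _ => Or.inr ⟨z, by rw [mul_one]⟩⟩
  · ext z
    exact ⟨fun _ => Or.inr ⟨y * z, by rw [← mul_assoc, h, one_mul]⟩,
      fun _ => Or.inr ⟨z, by rw [one_mul]⟩⟩

namespace PartialBrauer

open PartitionMonoid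

variable {n : ℕ}

theorem rank_mul_le_left (α β : PartialBrauer n) : (α * β).1.rank ≤ α.1.rank :=
  PartitionMonoid.rank_mul_le_left α.2 β.2

theorem rank_mul_le_right (α β : PartialBrauer n) : (α * β).1.rank ≤ β.1.rank :=
  PartitionMonoid.rank_mul_le_right α.2 β.2

/-- Permutations are invertible, and the removal of a horizontal edge is undone by a hook. Neither
operation leaves the `𝒥`-class, so induction on diagrams ends at a partial identity. -/
theorem exists_principalIdeal_eq_isolate (α : PartialBrauer n) :
    ∃ S, principalIdeal α = principalIdeal (⟨isolate S, isolate_mem S⟩ : PartialBrauer n) := by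
  obtain ⟨α, hα⟩ := α
  refine partialBrauer_induction (P := fun α => ∀ hα : α ∈ PartialBrauer n, ∃ S,
    principalIdeal (⟨α, hα⟩ : PartialBrauer n) = principalIdeal ⟨isolate S, isolate_mem S⟩)
    ?_ ?_ ?_ α hα hα
  · intro S σ hα
    refine ⟨S, Set.Subset.antisymm
      (principalIdeal_subset (s := 1) (t := ofPerm σ) (Subtype.ext ?_))
      (principalIdeal_subset (s := 1) (t := ofPerm σ⁻¹) (Subtype.ext ?_))⟩
    · change _ = 1 * isolate S * PartitionMonoid.ofPerm σ
      rw [one_mul]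
    · change _ = 1 * (isolate S * PartitionMonoid.ofPerm σ) * PartitionMonoid.ofPerm σ⁻¹
      rw [one_mul, mul_assoc, ofPerm_mul_ofPerm_inv, mul_one]
  · intro α hα a b hab h ih hα'
    obtain ⟨S, hS⟩ := ih (mul_mem (isolate_mem _) hα)
    refine ⟨S, Eq.trans (Set.Subset.antisymm
      (principalIdeal_subset (s := ⟨hook a b, hook_mem a b⟩) (t := 1) (Subtype.ext ?_))
      (principalIdeal_subset (s := ⟨isolate {a}, isolate_mem _⟩) (t := 1)
        (Subtype.ext ?_))) hS⟩
    · change _ = hook a b * (isolate {a} * α) * 1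
      rw [mul_one, hook_mul_isolate_mul hα hab h]
    · change _ = isolate {a} * α * 1
      rw [mul_one]
  · intro α hα a b hab h ih hα'
    obtain ⟨S, hS⟩ := ih (mul_mem hα (isolate_mem _))
    refine ⟨S, Eq.trans (Set.Subset.antisymm
      (principalIdeal_subset (s := 1) (t := ⟨hook a b, hook_mem a b⟩) (Subtype.ext ?_))
      (principalIdeal_subset (s := 1) (t := ⟨isolate {a}, isolate_mem _⟩)
        (Subtype.ext ?_))) hS⟩
    · change _ = 1 * (α * isolate {a}) * hook a b
      rw [one_mul, mul_isolate_mul_hook hα hab h]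
    · change _ = 1 * α * isolate {a}
      rw [one_mul]

theorem rank_eq_of_principalIdeal_eq {α β : PartialBrauer n}
    (h : principalIdeal α = principalIdeal β) : α.1.rank = β.1.rank := by
  have key : ∀ {α β : PartialBrauer n}, principalIdeal α = principalIdeal β →
      α.1.rank ≤ β.1.rank := by
    intro α β h
    obtain ⟨s, t, rfl⟩ := exists_mul_mul_of_principalIdeal_eq h
    exact (rank_mul_le_left _ _).trans (rank_mul_le_right _ _)
  exact le_antisymm (key h) (key h.symm)

/-- Some permutation carries `S` onto `T`, and conjugation by it relates the two partial identities.
-/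
theorem principalIdeal_isolate_subset {S T : Set (Fin n)} (h : S.ncard = T.ncard) :
    principalIdeal (⟨isolate S, isolate_mem S⟩ : PartialBrauer n) ⊆
      principalIdeal ⟨isolate T, isolate_mem T⟩ := by
  classical
  obtain ⟨e⟩ : Nonempty (S ≃ T) := by
    rw [← Cardinal.eq, ← Set.cast_ncard (Set.toFinite S), ← Set.cast_ncard (Set.toFinite T), h]
  let σ : Equiv.Perm (Fin n) := Equiv.extendSubtype (p := (· ∈ S)) (q := (· ∈ T)) e
  have hσ : σ ⁻¹' T = S := by
    ext i
    by_cases hi : i ∈ S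
    · simpa [hi] using Equiv.extendSubtype_mem (p := (· ∈ S)) (q := (· ∈ T)) e i hi
    · simpa [hi] using Equiv.extendSubtype_not_mem (p := (· ∈ S)) (q := (· ∈ T)) e i hi
  refine principalIdeal_subset (s := ofPerm σ) (t := ofPerm σ⁻¹) (Subtype.ext ?_)
  have := ofPerm_mul_isolate_mul_ofPerm σ T
  rw [hσ] at this
  exact this.symm

/-- Green's relation `𝒥` in the partial Brauer monoid is equality of ranks. -/
theorem principalIdeal_eq_iff {α β : PartialBrauer n} :
    principalIdeal α = principalIdeal β ↔ α.1.rank = β.1.rank := by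
  refine ⟨rank_eq_of_principalIdeal_eq, fun h => ?_⟩
  obtain ⟨S, hS⟩ := exists_principalIdeal_eq_isolate α
  obtain ⟨T, hT⟩ := exists_principalIdeal_eq_isolate β
  have hST : S.ncard = T.ncard := by
    have h1 := (rank_eq_of_principalIdeal_eq hS).trans (rank_isolate S)
    have h2 := (rank_eq_of_principalIdeal_eq hT).trans (rank_isolate T)
    have h3 := Set.ncard_add_ncard_compl S
    have h4 := Set.ncard_add_ncard_compl T
    omega
  rw [hS, hT]
  exact Set.Subset.antisymm (principalIdeal_isolate_subset hST)
    (principalIdeal_isolate_subset hST.symm)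

theorem mem_greenJClass {α β : PartialBrauer n} : β ∈ greenJClass α ↔ β.1.rank = α.1.rank :=
  principalIdeal_eq_iff

/-! ## The maximal subsemigroups -/

theorem ofPerm_injective : Function.Injective (ofPerm : Equiv.Perm (Fin n) → PartialBrauer n) := by
  intro σ τ h
  have h' : PartitionMonoid.ofPerm σ = PartitionMonoid.ofPerm τ := congrArg Subtype.val h
  ext i
  have : (PartitionMonoid.ofPerm σ).rel (Sum.inl i) (Sum.inr (σ i)) := rfl
  rw [h', ofPerm_rel_inl_inr] at this
  rw [this]

theorem mem_symmetricGroup_iff {α : PartialBrauer n} : α ∈ symmetricGroup n ↔ α.1.rank = n := by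
  constructor
  · rintro ⟨σ, rfl⟩
    exact rank_ofPerm σ
  · intro h
    obtain ⟨σ, hσ⟩ := exists_ofPerm_of_rank_eq α.2 h
    exact ⟨σ, Subtype.ext hσ.symm⟩

theorem ofPerm_mul_ofPerm (σ τ : Equiv.Perm (Fin n)) : ofPerm σ * ofPerm τ = ofPerm (τ * σ) :=
  Subtype.ext (PartitionMonoid.ofPerm_mul_ofPerm σ τ)

theorem ofPerm_mem_adjoinSubgroup {U : Subgroup (Equiv.Perm (Fin n))} {σ} :
    ofPerm σ ∈ adjoinSubgroup U ↔ σ ∈ U := by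
  simp [adjoinSubgroup, symmetricGroup, ofPerm_injective.eq_iff]

theorem mem_adjoinSubgroup_of_rank_ne (U : Subgroup (Equiv.Perm (Fin n))) {α : PartialBrauer n}
    (h : α.1.rank ≠ n) : α ∈ adjoinSubgroup U :=
  Or.inl ⟨trivial, fun h' => h (mem_symmetricGroup_iff.1 h')⟩

theorem mem_removeRank {α : PartialBrauer n} : α ∈ removeRank n ↔ α.1.rank ≠ n - 1 := by
  simp [removeRank]

theorem mem_removeKer {α : PartialBrauer n} :
    α ∈ removeKer n ↔ (α.1.rank = n - 2 → α.1.ker = ⊥) := by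
  simp [removeKer]

theorem mem_removeCoker {α : PartialBrauer n} :
    α ∈ removeCoker n ↔ (α.1.rank = n - 2 → α.1.coker = ⊥) := by
  simp [removeCoker]

theorem rank_le (α : PartialBrauer n) : α.1.rank ≤ n := PartitionMonoid.rank_le α.1 α.2

/-- A product of rank `n` has both factors of rank `n`, so the question reduces to closure of `U`;
nothing of smaller rank is removed. -/
theorem adjoinSubgroup_mul_mem (U : Subgroup (Equiv.Perm (Fin n))) {α β : PartialBrauer n}
    (hα : α ∈ adjoinSubgroup U) (hβ : β ∈ adjoinSubgroup U) : α * β ∈ adjoinSubgroup U := by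
  by_cases h : (α * β).1.rank = n
  · have h1 := rank_mul_le_left α β
    have h2 := rank_mul_le_right α β
    obtain ⟨σ, rfl⟩ := mem_symmetricGroup_iff.2 (le_antisymm (rank_le α) (h.symm.trans_le h1))
    obtain ⟨τ, rfl⟩ := mem_symmetricGroup_iff.2 (le_antisymm (rank_le β) (h.symm.trans_le h2))
    rw [ofPerm_mul_ofPerm, ofPerm_mem_adjoinSubgroup]
    rw [ofPerm_mem_adjoinSubgroup] at hα hβ
    exact U.mul_mem hβ hα
  · exact mem_adjoinSubgroup_of_rank_ne U h

/-- Factors of a product of rank `n - 1` have rank at least `n - 1`. If that value is excluded, both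
are permutations and the product has rank `n`. -/
theorem removeRank_mul_mem {α β : PartialBrauer n}
    (hα : α ∈ removeRank n) (hβ : β ∈ removeRank n) : α * β ∈ removeRank n := by
  rw [mem_removeRank] at *
  intro h
  have h1 := rank_mul_le_left α β
  have h2 := rank_mul_le_right α β
  have h3 := rank_le α
  have h4 := rank_le β
  obtain ⟨σ, rfl⟩ := mem_symmetricGroup_iff.2 (show α.1.rank = n by omega)
  obtain ⟨τ, rfl⟩ := mem_symmetricGroup_iff.2 (show β.1.rank = n by omega)
  rw [ofPerm_mul_ofPerm] at h
  -- This equality can hold only for `n = 0`, by truncated subtraction; then `α` itself has the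
  -- excluded rank.
  have h5 : n = n - 1 := (rank_ofPerm (τ * σ)).symm.trans h
  exact hα ((rank_ofPerm σ).trans h5)

/-- Both factors of a product of rank `n - 2` have rank at least `n - 2`. A non-trivial kernel would
force the rank to be exactly `n - 2`, which is excluded, so `ker_mul_eq_bot` applies. -/
theorem removeKer_mul_mem {α β : PartialBrauer n}
    (hα : α ∈ removeKer n) (hβ : β ∈ removeKer n) : α * β ∈ removeKer n := by
  rw [mem_removeKer] at *
  intro h
  have key : ∀ γ : PartialBrauer n, n - 2 ≤ γ.1.rank → (γ.1.rank = n - 2 → γ.1.ker = ⊥) →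
      γ.1.ker = ⊥ := by
    intro γ hγ h'
    by_contra hne
    have := rank_add_two_le γ.2 hne
    exact hne (h' (by omega))
  exact ker_mul_eq_bot (key α (h ▸ rank_mul_le_left α β) hα) (key β (h ▸ rank_mul_le_right α β) hβ)

/-- The involution of the partial Brauer monoid. -/
def star (α : PartialBrauer n) : PartialBrauer n := ⟨α.1.star, star_mem α.2⟩

theorem star_mul (α β : PartialBrauer n) : star (α * β) = star β * star α :=
  Subtype.ext (PartitionMonoid.star_mul α.1 β.1)

theorem mem_removeCoker_iff_star {α : PartialBrauer n} :
    α ∈ removeCoker n ↔ star α ∈ removeKer n := by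
  rw [mem_removeCoker, mem_removeKer]
  change _ ↔ (α.1.star.rank = n - 2 → _)
  rw [rank_star]
  rfl

theorem removeCoker_mul_mem {α β : PartialBrauer n}
    (hα : α ∈ removeCoker n) (hβ : β ∈ removeCoker n) : α * β ∈ removeCoker n := by
  rw [mem_removeCoker_iff_star] at *
  rw [star_mul]
  exact removeKer_mul_mem hβ hα

/-- Each hypothesis supplies one kind of generator for `partialBrauer_le`. The permutations in `T`
generate the symmetric group, being in no maximal subgroup, and by finiteness they already form a
subgroup. -/
theorem eq_top_of_not_subset (hn : 2 ≤ n) (T : Subsemigroup (PartialBrauer n))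
    (ha : ∀ U, IsCoatom U → ¬ (T : Set (PartialBrauer n)) ⊆ adjoinSubgroup U)
    (hb : ¬ (T : Set (PartialBrauer n)) ⊆ removeRank n)
    (hc : ¬ (T : Set (PartialBrauer n)) ⊆ removeKer n)
    (hd : ¬ (T : Set (PartialBrauer n)) ⊆ removeCoker n) : T = ⊤ := by
  have : Nontrivial (Fin n) := Fin.nontrivial_iff_two_le.2 hn
  let U : Subgroup (Equiv.Perm (Fin n)) := Subgroup.closure {σ | ofPerm σ ∈ T}
  have hU : U = ⊤ := by
    by_contra hne
    obtain ⟨V, hV, hUV⟩ := (eq_top_or_exists_le_coatom U).resolve_left hne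
    refine ha V hV fun α hα => ?_
    by_cases h : α.1.rank = n
    · obtain ⟨σ, rfl⟩ := mem_symmetricGroup_iff.2 h
      exact ofPerm_mem_adjoinSubgroup.2 (hUV (Subgroup.subset_closure hα))
    · exact mem_adjoinSubgroup_of_rank_ne V h
  -- Without any permutation in `T` the closure `U` would be trivial, but the symmetric group is
  -- not, since `n ≥ 2`.
  obtain ⟨σ₀, hσ₀⟩ : ∃ σ, ofPerm σ ∈ T := by
    by_contra! hne
    have : U = ⊥ := (Subgroup.closure_eq_bot_iff).2 fun σ hσ => absurd hσ (hne σ)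
    exact bot_ne_top (this.symm.trans hU)
  have hpow : ∀ σ, ofPerm σ ∈ T → ∀ k, ofPerm (σ ^ (k + 1)) ∈ T := by
    intro σ hσ k
    induction k with
    | zero => simpa using hσ
    | succ k ih =>
      rw [pow_succ, ← ofPerm_mul_ofPerm]
      exact T.mul_mem hσ ih
  have hone : ofPerm (1 : Equiv.Perm (Fin n)) ∈ T := by
    have := hpow σ₀ hσ₀ (orderOf σ₀ - 1)
    rwa [Nat.sub_add_cancel (orderOf_pos σ₀), pow_orderOf_eq_one] at this
  let W : Subgroup (Equiv.Perm (Fin n)) :=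
    { carrier := {σ | ofPerm σ ∈ T}
      mul_mem' := fun {σ τ} hσ hτ => by
        change ofPerm (σ * τ) ∈ T
        rw [← ofPerm_mul_ofPerm]
        exact T.mul_mem hτ hσ
      one_mem' := hone
      inv_mem' := fun {σ} hσ => by
        change ofPerm σ⁻¹ ∈ T
        -- The inverse is the power with exponent `orderOf σ - 1`. Only positive exponents are
        -- available in a subsemigroup, so order one is treated separately.
        rcases Nat.lt_or_ge 1 (orderOf σ) with h | h
        · have := hpow σ hσ (orderOf σ - 2)
          rwa [show orderOf σ - 2 + 1 = orderOf σ - 1 by omega, ← inv_eq_of_mul_eq_one_left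
            (show σ ^ (orderOf σ - 1) * σ = 1 by
              rw [pow_sub_one_mul (orderOf_pos σ).ne', pow_orderOf_eq_one])] at this
        · have h1 : orderOf σ = 1 := le_antisymm h (orderOf_pos σ)
          rw [orderOf_eq_one_iff.1 h1, inv_one]
          exact hone }
  have hW : U ≤ W := (Subgroup.closure_le W).2 fun σ hσ => hσ
  have hperm : ∀ σ, ofPerm σ ∈ T := fun σ => hW (hU ▸ Subgroup.mem_top σ)
  obtain ⟨β₁, hT₁, h₁⟩ := Set.not_subset.1 hb
  obtain ⟨β₂, hT₂, h₂⟩ := Set.not_subset.1 hc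
  obtain ⟨β₃, hT₃, h₃⟩ := Set.not_subset.1 hd
  rw [mem_removeRank, not_not] at h₁
  rw [mem_removeKer, Classical.not_imp] at h₂
  rw [mem_removeCoker, Classical.not_imp] at h₃
  refine (Subsemigroup.eq_top_iff' T).2 fun α => ?_
  obtain ⟨β, hβ, e⟩ := partialBrauer_le (T.map (PartialBrauer n).subtype.toMulHom) hn
    (fun σ => ⟨ofPerm σ, hperm σ, rfl⟩) ⟨_, ⟨β₁, hT₁, rfl⟩, β₁.2, h₁⟩
    ⟨_, ⟨β₂, hT₂, rfl⟩, β₂.2, h₂⟩ ⟨_, ⟨β₃, hT₃, rfl⟩, β₃.2, h₃⟩ α.2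
  rwa [← show β = α from Subtype.ext e]

end PartialBrauer

/-! ### Incomparability of the listed sets and the classification. -/

namespace PartialBrauer

open PartitionMonoid

variable {n : ℕ}

/-- The four families of maximal subsemigroups. -/
def IsListed (M : Set (PartialBrauer n)) : Prop :=
  (∃ U : Subgroup (Equiv.Perm (Fin n)), IsCoatom U ∧ M = adjoinSubgroup U) ∨
    M = removeRank n ∨ M = removeKer n ∨ M = removeCoker n

theorem rank_ofPerm (σ : Equiv.Perm (Fin n)) : (ofPerm σ).1.rank = n :=
  PartitionMonoid.rank_ofPerm σ

theorem ofPerm_mem_removeRank (hn : 2 ≤ n) (σ : Equiv.Perm (Fin n)) :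
    ofPerm σ ∈ removeRank n := by
  rw [mem_removeRank, rank_ofPerm]
  omega

theorem ofPerm_mem_removeKer (hn : 2 ≤ n) (σ : Equiv.Perm (Fin n)) :
    ofPerm σ ∈ removeKer n := by
  rw [mem_removeKer, rank_ofPerm]
  omega

theorem ofPerm_mem_removeCoker (hn : 2 ≤ n) (σ : Equiv.Perm (Fin n)) :
    ofPerm σ ∈ removeCoker n := by
  rw [mem_removeCoker, rank_ofPerm]
  omega

/-- Partial identities provide edge-free elements of each rank. In rank `n - 1` they separate
`removeRank` from the other sets, and in rank `n - 2` they show that `removeKer` and `removeCoker`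
meet their `𝒥`-class. -/
theorem exists_rank_eq (k : ℕ) (hk : k ≤ n) :
    ∃ α : PartialBrauer n, α.1.rank = k ∧ α.1.ker = ⊥ ∧ α.1.coker = ⊥ := by
  obtain ⟨S, -, hS⟩ := Set.exists_subset_card_eq (s := (Set.univ : Set (Fin n))) (n := n - k)
    (by simp)
  refine ⟨⟨isolate S, isolate_mem S⟩, ?_, ?_, ?_⟩
  · refine (rank_isolate S).trans ?_
    rw [Set.ncard_compl, Nat.card_fin]
    omega
  · exact ker_eq_bot_iff.2 fun i j h => (isolate_rel_inl_inl S i j).1 h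
  · exact coker_eq_bot_iff.2 fun i j h => (isolate_rel_inr_inr S i j).1 h

theorem exists_ker_ne_bot (hn : 2 ≤ n) :
    ∃ α : PartialBrauer n, α.1.rank = n - 2 ∧ α.1.ker ≠ ⊥ ∧ α.1.coker = ⊥ := by
  have : Nontrivial (Fin n) := Fin.nontrivial_iff_two_le.2 hn
  obtain ⟨a, b, hab⟩ := exists_pair_ne (Fin n)
  have hmem : hook a b * isolate {a, b} ∈ PartialBrauer n :=
    mul_mem (hook_mem a b) (isolate_mem _)
  have hk : (hook a b * isolate {a, b}).ker ≠ ⊥ := by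
    refine ker_ne_bot_iff.2 ⟨a, b, hab, ker_le_ker_mul _ _ ?_⟩
    exact (hook_rel_inl_inl a b a b).2 (by simp)
  refine ⟨⟨_, hmem⟩, ?_, hk, ?_⟩
  · have h1 := rank_add_two_le hmem hk
    -- Each `i` other than `a`, `b` keeps its edge to `i'`, which bounds the rank from below; the
    -- non-trivial kernel bounds it from above.
    have h2 : ({a, b} : Set (Fin n))ᶜ ⊆ (hook a b * isolate {a, b}).dom := by
      intro i hi
      have hi' : ¬ (i = a ∨ i = b) := hi
      refine ⟨i, (mul_isolate_rel _ _ _ _).2 (Or.inr ⟨by simp, by simpa using hi', ?_⟩)⟩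
      exact (hook_rel_inl_inr a b i i).2 ⟨rfl, hi'⟩
    have h3 := Set.ncard_le_ncard h2 (Set.toFinite _)
    rw [← rank_eq_ncard_dom hmem, Set.ncard_compl, Nat.card_fin, Set.ncard_pair hab] at h3
    change (hook a b * isolate {a, b}).rank = n - 2
    omega
  · refine coker_eq_bot_iff.2 fun i j h => ?_
    by_contra hne
    obtain ⟨hi, hj, h⟩ := ((mul_isolate_rel _ _ _ _).1 h).resolve_left (by simpa using hne)
    rw [hook_rel_inr_inr] at h
    exact hi ⟨i, (h.resolve_left hne).1, rfl⟩

theorem exists_coker_ne_bot (hn : 2 ≤ n) :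
    ∃ α : PartialBrauer n, α.1.rank = n - 2 ∧ α.1.ker = ⊥ ∧ α.1.coker ≠ ⊥ := by
  obtain ⟨α, h1, h2, h3⟩ := exists_ker_ne_bot hn
  refine ⟨star α, (rank_star α.1).trans h1, h3, ?_⟩
  change α.1.star.coker ≠ ⊥
  rwa [coker_star]

theorem exists_notMem_of_isCoatom {U : Subgroup (Equiv.Perm (Fin n))} (hU : IsCoatom U) :
    ∃ σ, σ ∉ U := by
  by_contra! h
  exact hU.1 ((Subgroup.eq_top_iff' U).2 h)

theorem adjoinSubgroup_subset_iff {U V : Subgroup (Equiv.Perm (Fin n))} :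
    adjoinSubgroup U ⊆ adjoinSubgroup V ↔ U ≤ V := by
  refine ⟨fun h σ hσ => ofPerm_mem_adjoinSubgroup.1 (h (ofPerm_mem_adjoinSubgroup.2 hσ)), ?_⟩
  intro h α hα
  exact hα.imp id fun ⟨σ, hσ, e⟩ => ⟨σ, h hσ, e⟩

theorem adjoinSubgroup_injective :
    Function.Injective (adjoinSubgroup : Subgroup (Equiv.Perm (Fin n)) → _) := fun _ _ h =>
  le_antisymm (adjoinSubgroup_subset_iff.1 h.subset) (adjoinSubgroup_subset_iff.1 h.symm.subset)

/-- The listed sets are pairwise incomparable. -/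
theorem IsListed.eq_of_subset (hn : 2 ≤ n) {M N : Set (PartialBrauer n)} (hM : IsListed M)
    (hN : IsListed N) (h : M ⊆ N) : M = N := by
  -- Each `N` misses an element that belongs to every listed set of another kind: a permutation
  -- outside `V`, an element of rank `n - 1`, or one of rank `n - 2` with edges in only one row. Two
  -- sets `adjoinSubgroup` are compared through maximality of the subgroups.
  rcases hN with ⟨V, hV, rfl⟩ | rfl | rfl | rfl
  · obtain ⟨σ, hσ⟩ := exists_notMem_of_isCoatom hV
    have hσ' : ofPerm σ ∉ adjoinSubgroup V := fun h => hσ (ofPerm_mem_adjoinSubgroup.1 h)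
    rcases hM with ⟨U, hU, rfl⟩ | rfl | rfl | rfl
    · rw [adjoinSubgroup_subset_iff] at h
      rcases hU.le_iff.1 h with h' | h'
      exacts [absurd h' hV.1, by rw [h']]
    · exact absurd (h (ofPerm_mem_removeRank hn σ)) hσ'
    · exact absurd (h (ofPerm_mem_removeKer hn σ)) hσ'
    · exact absurd (h (ofPerm_mem_removeCoker hn σ)) hσ'
  · obtain ⟨α, hr, hk, hc⟩ := exists_rank_eq (n - 1) (Nat.sub_le n 1)
    have hα : α ∉ removeRank n := fun h => mem_removeRank.1 h hr
    rcases hM with ⟨U, hU, rfl⟩ | rfl | rfl | rfl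
    · exact absurd (h (mem_adjoinSubgroup_of_rank_ne U (by omega))) hα
    · rfl
    · exact absurd (h (mem_removeKer.2 fun _ => hk)) hα
    · exact absurd (h (mem_removeCoker.2 fun _ => hc)) hα
  · obtain ⟨α, hr, hk, hc⟩ := exists_ker_ne_bot hn
    have hα : α ∉ removeKer n := fun h => hk (mem_removeKer.1 h hr)
    rcases hM with ⟨U, hU, rfl⟩ | rfl | rfl | rfl
    · exact absurd (h (mem_adjoinSubgroup_of_rank_ne U (by omega))) hα
    · exact absurd (h (mem_removeRank.2 (by omega))) hα
    · rfl
    · exact absurd (h (mem_removeCoker.2 fun _ => hc)) hα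
  · obtain ⟨α, hr, hk, hc⟩ := exists_coker_ne_bot hn
    have hα : α ∉ removeCoker n := fun h => hc (mem_removeCoker.1 h hr)
    rcases hM with ⟨U, hU, rfl⟩ | rfl | rfl | rfl
    · exact absurd (h (mem_adjoinSubgroup_of_rank_ne U (by omega))) hα
    · exact absurd (h (mem_removeRank.2 (by omega))) hα
    · exact absurd (h (mem_removeKer.2 fun _ => hk)) hα
    · rfl

/-- If the whole monoid were listed, incomparability would make it equal to `removeKer n`, which is
proper. -/
theorem IsListed.ne_univ (hn : 2 ≤ n) {M : Set (PartialBrauer n)} (hM : IsListed M) :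
    M ≠ Set.univ := by
  rintro rfl
  have h1 := hM.eq_of_subset hn (Or.inr (Or.inr (Or.inl rfl)))
  have h2 : IsListed (removeKer n) := Or.inr (Or.inr (Or.inl rfl))
  obtain ⟨α, hr, hk, hc⟩ := exists_ker_ne_bot hn
  have h3 := h2.eq_of_subset hn hM (Set.subset_univ _)
  have hα : α ∈ removeKer n := h3 ▸ Set.mem_univ α
  exact hk (mem_removeKer.1 hα hr)

theorem IsListed.exists_subsemigroup {M : Set (PartialBrauer n)} (hM : IsListed M) :
    ∃ T : Subsemigroup (PartialBrauer n), (T : Set (PartialBrauer n)) = M := by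
  rcases hM with ⟨U, hU, rfl⟩ | rfl | rfl | rfl
  · exact ⟨⟨_, adjoinSubgroup_mul_mem U⟩, rfl⟩
  · exact ⟨⟨_, removeRank_mul_mem⟩, rfl⟩
  · exact ⟨⟨_, removeKer_mul_mem⟩, rfl⟩
  · exact ⟨⟨_, removeCoker_mul_mem⟩, rfl⟩

theorem exists_isListed_of_ne_top (hn : 2 ≤ n) {T : Subsemigroup (PartialBrauer n)}
    (hT : T ≠ ⊤) : ∃ M, IsListed M ∧ (T : Set (PartialBrauer n)) ⊆ M := by
  by_contra! h
  exact hT (eq_top_of_not_subset hn T (fun U hU => h _ (Or.inl ⟨U, hU, rfl⟩))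
    (h _ (Or.inr (Or.inl rfl))) (h _ (Or.inr (Or.inr (Or.inl rfl))))
    (h _ (Or.inr (Or.inr (Or.inr rfl)))))

/-- Pure order theory: the listed sets are proper, pairwise incomparable subsemigroups, and every
proper subsemigroup lies in one of them. -/
theorem isMaximalSubsemigroup_iff (hn : 2 ≤ n) (M : Set (PartialBrauer n)) :
    IsMaximalSubsemigroup M ↔ IsListed M := by
  constructor
  · rintro ⟨T, hT, rfl⟩
    obtain ⟨M, hM, hTM⟩ := exists_isListed_of_ne_top hn hT.1
    obtain ⟨T', rfl⟩ := hM.exists_subsemigroup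
    rcases hT.le_iff.1 (show T ≤ T' from hTM) with h | h
    · exact absurd (by rw [h]; rfl) (hM.ne_univ hn)
    · rwa [← h]
  · intro hM
    obtain ⟨T, rfl⟩ := hM.exists_subsemigroup
    refine ⟨T, ⟨?_, fun T' hT' => ?_⟩, rfl⟩
    · rintro rfl
      exact hM.ne_univ hn rfl
    · by_contra hne
      obtain ⟨N, hN, hTN⟩ := exists_isListed_of_ne_top hn hne
      have := hM.eq_of_subset hn hN (Set.Subset.trans hT'.le hTN)
      exact hT'.not_ge (show (T' : Set (PartialBrauer n)) ⊆ T by rw [this]; exact hTN)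

/-! ### The types of the maximal subsemigroups. -/

/-- The `𝒥`-class is the group of units, where every `ℋ`-class contains the identity, an element of
`U`. -/
theorem hasTypeMeetsH_adjoinSubgroup (U : Subgroup (Equiv.Perm (Fin n))) :
    HasTypeMeetsH (adjoinSubgroup U) := by
  have hone : (1 : PartialBrauer n).1.rank = n := rank_ofPerm 1
  refine ⟨greenJClass 1, ⟨⟨1, rfl⟩, fun α hα => ?_⟩, fun α hα => ?_⟩
  · rw [mem_greenJClass, hone]
    by_contra h
    exact hα (mem_adjoinSubgroup_of_rank_ne U h)
  · rw [mem_greenJClass, hone] at hα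
    obtain ⟨σ, rfl⟩ := mem_symmetricGroup_iff.2 hα
    refine ⟨1, ⟨ofPerm_mem_adjoinSubgroup.2 U.one_mem, rfl⟩,
      one_mem_greenHClass (y := ofPerm σ⁻¹) ?_ ?_⟩
    · rw [ofPerm_mul_ofPerm, inv_mul_cancel]; rfl
    · rw [ofPerm_mul_ofPerm, mul_inv_cancel]; rfl

theorem hasTypeDisjoint_removeRank : HasTypeDisjoint (removeRank n) := by
  obtain ⟨α, hr, -, -⟩ := exists_rank_eq (n - 1) (Nat.sub_le n 1)
  refine ⟨greenJClass α, ⟨⟨α, rfl⟩, fun β hβ => ?_⟩, ?_⟩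
  · rw [mem_greenJClass, hr]
    by_contra h
    exact hβ (mem_removeRank.2 h)
  · refine Set.eq_empty_of_forall_notMem ?_
    rintro β ⟨h1, h2⟩
    rw [mem_greenJClass, hr] at h2
    exact mem_removeRank.1 h1 h2

/-- Right multiplication can only enlarge the kernel, so an element `ℛ`-related to one with trivial
kernel has trivial kernel. -/
theorem hasTypeUnionR_removeKer : HasTypeUnionR (removeKer n) := by
  obtain ⟨α, hr, hk, -⟩ := exists_rank_eq (n - 2) (Nat.sub_le n 2)
  refine ⟨greenJClass α, ⟨⟨α, rfl⟩, fun β hβ => ?_⟩, ⟨α, mem_removeKer.2 fun _ => hk, rfl⟩, ?_⟩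
  · rw [mem_greenJClass, hr]
    by_contra h
    exact hβ (mem_removeKer.2 fun h' => absurd h' h)
  · rintro β ⟨h1, h2⟩ γ hγ
    have hγJ : γ ∈ greenJClass α := (greenRClass_subset_greenJClass β hγ).trans h2
    refine ⟨mem_removeKer.2 fun _ => ?_, hγJ⟩
    rw [mem_greenJClass, hr] at h2
    obtain ⟨t, rfl⟩ := exists_mul_of_principalRightIdeal_eq (Eq.symm hγ)
    exact le_bot_iff.1 ((ker_le_ker_mul γ.1 t.1).trans (mem_removeKer.1 h1 h2).le)

theorem hasTypeUnionL_removeCoker : HasTypeUnionL (removeCoker n) := by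
  obtain ⟨α, hr, -, hk⟩ := exists_rank_eq (n - 2) (Nat.sub_le n 2)
  refine ⟨greenJClass α, ⟨⟨α, rfl⟩, fun β hβ => ?_⟩, ⟨α, mem_removeCoker.2 fun _ => hk, rfl⟩, ?_⟩
  · rw [mem_greenJClass, hr]
    by_contra h
    exact hβ (mem_removeCoker.2 fun h' => absurd h' h)
  · rintro β ⟨h1, h2⟩ γ hγ
    have hγJ : γ ∈ greenJClass α := (greenLClass_subset_greenJClass β hγ).trans h2
    refine ⟨mem_removeCoker.2 fun _ => ?_, hγJ⟩
    rw [mem_greenJClass, hr] at h2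
    obtain ⟨t, rfl⟩ := exists_mul_of_principalLeftIdeal_eq (Eq.symm hγ)
    have h3 : (t.1 * γ.1).coker = ⊥ := mem_removeCoker.1 h1 h2
    rw [coker, PartitionMonoid.star_mul] at h3
    exact le_bot_iff.1 ((ker_le_ker_mul γ.1.star t.1.star).trans h3.le)

/-! ### The number of maximal subsemigroups. -/

theorem ncard_isMaximalSubsemigroup (hn : 2 ≤ n) :
    {M : Set (PartialBrauer n) | IsMaximalSubsemigroup M}.ncard =
      {U : Subgroup (Equiv.Perm (Fin n)) | IsCoatom U}.ncard + 3 := by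
  have hset : {M : Set (PartialBrauer n) | IsMaximalSubsemigroup M} =
      insert (removeRank n) (insert (removeKer n) (insert (removeCoker n)
        (adjoinSubgroup '' {U | IsCoatom U}))) := by
    ext M
    refine (isMaximalSubsemigroup_iff hn M).trans ?_
    simp only [IsListed, Set.mem_insert_iff, Set.mem_image, Set.mem_ofPred_eq, eq_comm (b := M)]
    rw [or_comm, or_assoc, or_assoc]
  -- `Set.ncard` is `0` on infinite sets, so each insertion count requires finiteness.
  have hfin : (adjoinSubgroup '' {U : Subgroup (Equiv.Perm (Fin n)) | IsCoatom U}).Finite :=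
    (Set.toFinite _).image _
  -- The three witnesses show that each inserted set differs from those inserted before it.
  obtain ⟨α₁, hr₁, hk₁, hc₁⟩ := exists_rank_eq (n - 1) (Nat.sub_le n 1)
  obtain ⟨α₂, hr₂, hk₂, hc₂⟩ := exists_ker_ne_bot hn
  obtain ⟨α₃, hr₃, hk₃, hc₃⟩ := exists_coker_ne_bot hn
  have h₁ : α₁ ∉ removeRank n := fun h => mem_removeRank.1 h hr₁
  have h₂ : α₂ ∉ removeKer n := fun h => hk₂ (mem_removeKer.1 h hr₂)
  have h₃ : α₃ ∉ removeCoker n := fun h => hc₃ (mem_removeCoker.1 h hr₃)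
  rw [hset, Set.ncard_insert_of_notMem _ ((hfin.insert _).insert _),
    Set.ncard_insert_of_notMem _ (hfin.insert _), Set.ncard_insert_of_notMem _ hfin,
    Set.ncard_image_of_injective _ adjoinSubgroup_injective]
  · rintro ⟨U, -, h⟩
    exact h₃ (h ▸ mem_adjoinSubgroup_of_rank_ne U (by omega))
  · rintro (h | ⟨U, -, h⟩)
    · exact h₂ (h ▸ mem_removeCoker.2 fun _ => hc₂)
    · exact h₂ (h ▸ mem_adjoinSubgroup_of_rank_ne U (by omega))
  · rintro (h | h | ⟨U, -, h⟩)
    · exact h₁ (h ▸ mem_removeKer.2 fun _ => hk₁)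
    · exact h₁ (h ▸ mem_removeCoker.2 fun _ => hc₁)
    · exact h₁ (h ▸ mem_adjoinSubgroup_of_rank_ne U (by omega))

/-! ## Degree one -/

theorem degree_one_eq_top : PartialBrauer 1 = ⊤ := by
  refine (Submonoid.eq_top_iff' _).2 fun α b _ => ?_
  simpa using Set.ncard_le_card b

/-- The idempotent of rank zero in degree one. -/
noncomputable def degreeOneZero : PartialBrauer 1 := ⟨isolate Set.univ, isolate_mem _⟩

theorem degreeOneZero_ne_one : degreeOneZero ≠ 1 := by
  intro h
  have h0 : isolate (Set.univ : Set (Fin 1)) = isolate ∅ := by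
    rw [isolate_empty]
    exact congrArg Subtype.val h
  have h1 : (isolate (Set.univ : Set (Fin 1))).rel (Sum.inl 0) (Sum.inr 0) := by
    rw [h0, isolate_rel_inl_inr]
    simp
  rw [isolate_rel_inl_inr] at h1
  simp at h1

/-- With one point per row there are no horizontal edges and only one permutation, so `α` is a
partial identity on none or all of the points. -/
theorem degree_one_cases (α : PartialBrauer 1) : α = 1 ∨ α = degreeOneZero := by
  have hk : α.1.ker = ⊥ := ker_eq_bot_iff.2 fun i j _ => Subsingleton.elim i j
  have hc : α.1.coker = ⊥ := coker_eq_bot_iff.2 fun i j _ => Subsingleton.elim i j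
  obtain ⟨σ, hσ⟩ := exists_isolate_mul_ofPerm hk hc
  rw [Subsingleton.elim σ 1, ofPerm_one, mul_one] at hσ
  rcases (α.1.domᶜ).eq_empty_or_nonempty with h | h
  · rw [h, isolate_empty] at hσ
    exact Or.inl (Subtype.ext hσ)
  · rw [Subsingleton.eq_univ_of_nonempty h] at hσ
    exact Or.inr (Subtype.ext hσ)

theorem degreeOneZero_mul_self : degreeOneZero * degreeOneZero = degreeOneZero := by
  refine Subtype.ext ?_
  change isolate Set.univ * isolate Set.univ = isolate Set.univ
  rw [isolate_mul_isolate, Set.union_self]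

theorem degree_one_mul_self (α : PartialBrauer 1) : α * α = α := by
  rcases degree_one_cases α with rfl | rfl
  exacts [one_mul 1, degreeOneZero_mul_self]

theorem degree_one_mul_comm (α β : PartialBrauer 1) : α * β = β * α := by
  rcases degree_one_cases α with rfl | rfl <;> rcases degree_one_cases β with rfl | rfl <;> simp

theorem card_degree_one : Nat.card (PartialBrauer 1) = 2 := by
  refine Nat.card_eq_two_iff.2 ⟨1, degreeOneZero, degreeOneZero_ne_one.symm, ?_⟩
  exact Set.eq_univ_of_forall fun α => by simpa using degree_one_cases α

/-- Both elements are idempotent, so singletons are subsemigroups. In a two-element monoid every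
proper subset lies in a singleton, and anything strictly larger than a singleton is everything. -/
theorem degree_one_isMaximalSubsemigroup_iff (M : Set (PartialBrauer 1)) :
    IsMaximalSubsemigroup M ↔ ∃ α, M = {α} := by
  let S : PartialBrauer 1 → Subsemigroup (PartialBrauer 1) := fun α =>
    ⟨{α}, by rintro _ _ rfl rfl; exact degree_one_mul_self _⟩
  have hother : ∀ α : PartialBrauer 1, ∃ β, β ≠ α ∧ ∀ γ, γ ≠ β → γ = α := by
    intro α
    rcases degree_one_cases α with rfl | rfl
    · exact ⟨degreeOneZero, degreeOneZero_ne_one,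
        fun γ hγ => (degree_one_cases γ).resolve_right hγ⟩
    · exact ⟨1, degreeOneZero_ne_one.symm, fun γ hγ => (degree_one_cases γ).resolve_left hγ⟩
  have hS : ∀ α, S α ≠ ⊤ := by
    intro α h
    obtain ⟨β, hβ, -⟩ := hother α
    exact hβ (show β ∈ S α from h ▸ Subsemigroup.mem_top β)
  constructor
  · rintro ⟨T, hT, rfl⟩
    obtain ⟨β, hβ⟩ : ∃ β, β ∉ T := by
      by_contra! h
      exact hT.1 ((Subsemigroup.eq_top_iff' T).2 h)
    obtain ⟨α, hα, hα'⟩ := hother β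
    refine ⟨α, ?_⟩
    -- `T` could a priori be empty; the inclusion in the proper subsemigroup `S α` and maximality of
    -- `T` force equality.
    have hle : T ≤ S α := fun γ hγ => by
      by_contra hne
      have : γ = β := hα' γ hne
      exact hβ (this ▸ hγ)
    rw [← (hT.le_iff.1 hle).resolve_left (hS α)]
    rfl
  · rintro ⟨α, rfl⟩
    refine ⟨S α, ⟨hS α, fun T hT => ?_⟩, rfl⟩
    obtain ⟨β, hβT, hβ⟩ := SetLike.exists_of_lt hT
    obtain ⟨γ, -, hγ⟩ := hother β
    refine (Subsemigroup.eq_top_iff' T).2 fun δ => ?_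
    by_cases h : δ = α
    · exact hT.le h
    · obtain ⟨ε, -, hε⟩ := hother α
      have h1 : δ = ε := by
        by_contra hne
        exact h (hε δ hne)
      have h2 : β = ε := by
        by_contra hne
        exact hβ (hε β hne)
      rw [h1, ← h2]
      exact hβT

end PartialBrauer

theorem mainTheorem2 :
    (∀ n : ℕ, 2 ≤ n →
      (∀ M : Set (PartialBrauer n), IsMaximalSubsemigroup M ↔
        (∃ U : Subgroup (Equiv.Perm (Fin n)), IsCoatom U ∧ M = PartialBrauer.adjoinSubgroup U) ∨
        M = PartialBrauer.removeRank n ∨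
        M = PartialBrauer.removeKer n ∨
        M = PartialBrauer.removeCoker n) ∧
      (∀ U : Subgroup (Equiv.Perm (Fin n)), IsCoatom U →
        HasTypeMeetsH (PartialBrauer.adjoinSubgroup U)) ∧
      HasTypeDisjoint (PartialBrauer.removeRank n) ∧
      HasTypeUnionR (PartialBrauer.removeKer n) ∧
      HasTypeUnionL (PartialBrauer.removeCoker n) ∧
      {M : Set (PartialBrauer n) | IsMaximalSubsemigroup M}.ncard =
        {U : Subgroup (Equiv.Perm (Fin n)) | IsCoatom U}.ncard + 3) ∧
    (PartialBrauer 1 = ⊤ ∧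
      (∀ α β : PartialBrauer 1, α * β = β * α) ∧
      (∀ α : PartialBrauer 1, α * α = α) ∧
      Nat.card (PartialBrauer 1) = 2 ∧
      ∀ M : Set (PartialBrauer 1), IsMaximalSubsemigroup M ↔ ∃ α, M = {α}) :=
  ⟨fun _ hn => ⟨PartialBrauer.isMaximalSubsemigroup_iff hn,
      fun U _ => PartialBrauer.hasTypeMeetsH_adjoinSubgroup U,
      PartialBrauer.hasTypeDisjoint_removeRank, PartialBrauer.hasTypeUnionR_removeKer,
      PartialBrauer.hasTypeUnionL_removeCoker, PartialBrauer.ncard_isMaximalSubsemigroup hn⟩,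
    PartialBrauer.degree_one_eq_top, PartialBrauer.degree_one_mul_comm,
    PartialBrauer.degree_one_mul_self, PartialBrauer.card_degree_one,
    PartialBrauer.degree_one_isMaximalSubsemigroup_iff⟩
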